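/- Let $\mathscr H$ be the Hilbert space of locally absolutely continuous functions $u:[0,\infty)\to\mathbb C$ with $u(0)=0$ and $\int_0^\infty\bigl(|u'|^2+\tfrac{2}{r^2}|u|^2\bigr)\,dr<\infty$, with the scalar product $$\langle u,v\rangle=\int_0^\infty\Bigl(\overline{u'}\,v'+\frac{2}{r^2}\,\overline{u}\,v\Bigr)dr ,$$ and let $T=-\frac{d^2}{dr^2}+\frac{2}{r^2}$. Let $\tilde T$ be the restriction of $T$ to the domain $$\mathcal W_0=\{u\in C^\infty([0,\infty)):\ u\in\mathscr H,\ Tu\in\mathscr H,\ u''(0)=0\}.$$ For $\kappa\in\mathbb R$ let $T_\kappa$ be the operator $$T_\kappa u=Tu-\frac{2}{r}\,u'(0)=-u''+\frac{2}{r^2}u-\frac{2}{r}\,u'(0)$$ with domain $$\mathcal W_\kappa=\{u\in\mathscr H:\ u \text{ is twice differentiable on }[0,\infty),\ T_\kappa u\in\mathscr H,\ 3u''(0)=4\kappa u'(0)\}$$ (derivatives at $0$ are one-sided). Then, for every $\kappa\in\mathbb R$, the operator $\tilde T$ is densely defined and symmetric in $\mathscr H$, $\tilde T\subset T_\kappa$,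 and $T_\kappa$ is self-adjoint in $\mathscr H$. That is, $T_\kappa$ on $\mathcal W_\kappa$ is a self-adjoint extension of the symmetric operator $\tilde T$ in $\langle\cdot,\cdot\rangle$. -/

import Mathlib

open MeasureTheory Set Filter Topology
open scoped ComplexConjugate ContDiff

noncomputable section

namespace RadialLaplace

/-- Lebesgue measure on the half-axis `(0, ∞)`. -/
def hl : Measure ℝ := volume.restrict (Ioi 0)

/-- The derivative of a function on the half-axis `[0, ∞)`: it is the ordinary derivative at every
`r > 0` (see `dr_eq_deriv`), and the one-sided derivative at `r = 0`. -/
def dr (u : ℝ → ℂ) : ℝ → ℂ := derivWithin u (Ici 0)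

theorem dr_eq_deriv (u : ℝ → ℂ) {r : ℝ} (hr : 0 < r) : dr u r = deriv u r :=
  derivWithin_of_mem_nhds (Ici_mem_nhds hr)

/-- Membership in the space `ℋ` of functions on the half-axis: `u` is locally absolutely continuous
on `[0, ∞)`, vanishes at zero, and `∫₀^∞ (|u'|² + (2/r²) |u|²) dr < ∞`.

A function on the half-axis is represented by its extension to `ℝ` by the value `0`; the values on
`(-∞, 0)` carry no information, and the normalization only makes the representation unique. -/
structure MemH (u : ℝ → ℂ) : Prop where
  zero_of_nonpos : ∀ r ≤ 0, u r = 0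
  ac : ∀ b, 0 < b → AbsolutelyContinuousOnInterval u 0 b
  memLp_dr : MemLp (dr u) 2 hl
  memLp_div : MemLp (fun r : ℝ => u r / (r : ℂ)) 2 hl

/-! ### Linearity -/

theorem ae_differentiableAt_of_ac {u : ℝ → ℂ}
    (h : ∀ b, 0 < b → AbsolutelyContinuousOnInterval u 0 b) :
    ∀ᵐ r ∂hl, DifferentiableAt ℝ u r := by
  rw [hl, ae_restrict_iff' measurableSet_Ioi]
  have h1 : ∀ n : ℕ, ∀ᵐ r : ℝ, r ∈ uIcc 0 ((n : ℝ) + 1) → DifferentiableAt ℝ u r := fun n =>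
    (h (n + 1) (by positivity)).boundedVariationOn.ae_differentiableAt_of_mem_uIcc
  filter_upwards [ae_all_iff.2 h1] with r hr hr0
  obtain ⟨n, hn⟩ := exists_nat_gt r
  refine hr n ?_
  rw [uIcc_of_le (by positivity)]
  exact ⟨(mem_Ioi.1 hr0).le, by linarith⟩

theorem MemH.ae_differentiableAt {u : ℝ → ℂ} (h : MemH u) :
    ∀ᵐ r ∂hl, DifferentiableAt ℝ u r := ae_differentiableAt_of_ac h.ac

theorem ae_hl_pos : ∀ᵐ r ∂hl, 0 < r := ae_restrict_mem measurableSet_Ioi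

theorem MemH.dr_add {u v : ℝ → ℂ} (hu : MemH u) (hv : MemH v) :
    dr (u + v) =ᵐ[hl] dr u + dr v := by
  filter_upwards [hu.ae_differentiableAt, hv.ae_differentiableAt, ae_hl_pos] with r h1 h2 hr
  simp only [Pi.add_apply, dr_eq_deriv _ hr]
  exact deriv_add h1 h2

theorem MemH.dr_smul {u : ℝ → ℂ} (c : ℂ) (hu : MemH u) :
    dr (c • u) =ᵐ[hl] c • dr u := by
  filter_upwards [hu.ae_differentiableAt, ae_hl_pos] with r h1 hr
  simp only [Pi.smul_apply, dr_eq_deriv _ hr]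
  exact deriv_const_smul c h1

theorem MemH.zero : MemH 0 where
  zero_of_nonpos _ _ := rfl
  ac b _ := by
    have : LipschitzOnWith 0 (0 : ℝ → ℂ) (uIcc 0 b) := fun x _ y _ => by simp
    exact this.absolutelyContinuousOnInterval
  memLp_dr := by
    have : dr 0 = 0 := by
      funext r
      exact congrFun (derivWithin_const (s := Ici (0 : ℝ)) (c := (0 : ℂ))) r
    rw [this]
    exact MemLp.zero
  memLp_div := by simp

theorem MemH.add {u v : ℝ → ℂ} (hu : MemH u) (hv : MemH v) : MemH (u + v) where
  zero_of_nonpos r hr := by simp [hu.zero_of_nonpos r hr, hv.zero_of_nonpos r hr]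
  ac b hb := (hu.ac b hb).add (hv.ac b hb)
  memLp_dr := (memLp_congr_ae (hu.dr_add hv)).2 (hu.memLp_dr.add hv.memLp_dr)
  memLp_div := by
    have := hu.memLp_div.add hv.memLp_div
    refine (memLp_congr_ae (Eventually.of_forall fun r => ?_)).1 this
    simp [add_div]

theorem MemH.smul {u : ℝ → ℂ} (c : ℂ) (hu : MemH u) : MemH (c • u) where
  zero_of_nonpos r hr := by simp [hu.zero_of_nonpos r hr]
  ac b hb := (hu.ac b hb).const_smul c
  memLp_dr := (memLp_congr_ae (hu.dr_smul c)).2 (hu.memLp_dr.const_smul c)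
  memLp_div := by
    have := hu.memLp_div.const_smul c
    refine (memLp_congr_ae (Eventually.of_forall fun r => ?_)).1 this
    simp [mul_div_assoc]

/-- The functions that make up `ℋ`, as a complex vector space. -/
def HFun : Submodule ℂ (ℝ → ℂ) where
  carrier := {u | MemH u}
  add_mem' := MemH.add
  zero_mem' := MemH.zero
  smul_mem' c _ h := MemH.smul c h

/-- The Hilbert space `ℋ`. Its elements are the functions `u` with `MemH u`; its topology is the
one given by the scalar product below (and not the pointwise one). -/
def H : Type := ↥HFun

instance : AddCommGroup H := inferInstanceAs (AddCommGroup ↥HFun)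
instance : Module ℂ H := inferInstanceAs (Module ℂ ↥HFun)

/-- The function underlying an element of `ℋ`. -/
def H.fn (u : H) : ℝ → ℂ := Subtype.val (p := fun u => u ∈ HFun) u

/-- The element of `ℋ` with a given underlying function. -/
def H.mk (u : ℝ → ℂ) (hu : MemH u) : H := (⟨u, hu⟩ : ↥HFun)

theorem H.memH (u : H) : MemH u.fn := Subtype.property (p := fun u => u ∈ HFun) u

@[simp] theorem H.fn_mk (u : ℝ → ℂ) (hu : MemH u) : (H.mk u hu).fn = u := rfl

@[ext] theorem H.ext {u v : H} (h : u.fn = v.fn) : u = v := Subtype.ext h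

@[simp] theorem H.fn_add (u v : H) : (u + v).fn = u.fn + v.fn := rfl
@[simp] theorem H.fn_smul (c : ℂ) (u : H) : (c • u).fn = c • u.fn := rfl
@[simp] theorem H.fn_zero : (0 : H).fn = 0 := rfl
@[simp] theorem H.fn_neg (u : H) : (-u).fn = -u.fn := rfl
@[simp] theorem H.fn_sub (u v : H) : (u - v).fn = u.fn - v.fn := rfl

/-! ### The scalar product -/

/-- The scalar product `⟨u, v⟩ = ∫₀^∞ (conj(u') v' + (2/r²) conj(u) v) dr`. -/
def angle (u v : ℝ → ℂ) : ℂ :=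
  ∫ r : ℝ, (conj (dr u r) * dr v r + 2 / (r : ℂ) ^ 2 * (conj (u r) * v r)) ∂hl

/-- `u ↦ u'` as a map into `L²(0, ∞)`. -/
def derivL : H →ₗ[ℂ] Lp ℂ 2 hl where
  toFun u := u.memH.memLp_dr.toLp _
  map_add' u v := by
    rw [← MemLp.toLp_add]
    exact MemLp.toLp_congr _ _ (u.memH.dr_add v.memH)
  map_smul' c u := by
    rw [RingHom.id_apply, ← MemLp.toLp_const_smul]
    exact MemLp.toLp_congr _ _ (u.memH.dr_smul c)

/-- `u ↦ u / r` as a map into `L²(0, ∞)`. -/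
def divL : H →ₗ[ℂ] Lp ℂ 2 hl where
  toFun u := u.memH.memLp_div.toLp _
  map_add' u v := by
    rw [← MemLp.toLp_add]
    exact MemLp.toLp_congr _ _ (Eventually.of_forall fun r => by simp [add_div])
  map_smul' c u := by
    rw [RingHom.id_apply, ← MemLp.toLp_const_smul]
    exact MemLp.toLp_congr _ _ (Eventually.of_forall fun r => by simp [mul_div_assoc])

theorem coeFn_derivL (u : H) : derivL u =ᵐ[hl] dr u.fn :=
  MemLp.coeFn_toLp u.memH.memLp_dr

theorem coeFn_divL (u : H) : divL u =ᵐ[hl] fun r : ℝ => u.fn r / (r : ℂ) :=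
  MemLp.coeFn_toLp u.memH.memLp_div

theorem angle_eq (u v : H) :
    angle u.fn v.fn = inner ℂ (derivL u) (derivL v) + 2 * inner ℂ (divL u) (divL v) := by
  rw [L2.inner_def, L2.inner_def, ← integral_const_mul, ← integral_add]
  · refine integral_congr_ae ?_
    filter_upwards [coeFn_derivL u, coeFn_derivL v, coeFn_divL u, coeFn_divL v, ae_hl_pos]
      with r h1 h2 h3 h4 hr
    have hr' : (r : ℂ) ≠ 0 := by exact_mod_cast hr.ne'
    rw [h1, h2, h3, h4]
    simp only [RCLike.inner_apply, map_div₀, Complex.conj_ofReal]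
    field_simp
  · exact L2.integrable_inner _ _
  · exact (L2.integrable_inner _ _).const_mul _

theorem angle_self (u : H) :
    angle u.fn u.fn = ((‖derivL u‖ ^ 2 + 2 * ‖divL u‖ ^ 2 : ℝ) : ℂ) := by
  rw [angle_eq, inner_self_eq_norm_sq_to_K, inner_self_eq_norm_sq_to_K]
  push_cast
  rfl

/-! ### Functions in `ℋ` are the integrals of their derivatives -/

theorem intervalIntegrable_of_memLp {g : ℝ → ℂ} (hg : MemLp g 2 hl) {b : ℝ} (hb : 0 ≤ b) :
    IntervalIntegrable g volume 0 b := by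
  rw [intervalIntegrable_iff_integrableOn_Ioc_of_le hb]
  have h1 : MemLp g 2 (volume.restrict (Ioc 0 b)) :=
    hg.mono_measure (Measure.restrict_mono Ioc_subset_Ioi_self le_rfl)
  exact h1.integrable (by norm_num)

theorem ac_intervalIntegral {g : ℝ → ℂ} {b : ℝ} (hg : IntervalIntegrable g volume 0 b) :
    AbsolutelyContinuousOnInterval (fun r => ∫ t in 0..r, g t) 0 b := by
  have hd : IntervalIntegrable (fun t => ‖g t‖) volume 0 b := hg.norm
  have hn := hd.absolutelyContinuousOnInterval_intervalIntegral (c := 0) (by simp)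
  refine squeeze_zero' (Eventually.of_forall fun E => Finset.sum_nonneg fun i _ => dist_nonneg) ?_ hn
  have hmem : ∀ᶠ E in AbsolutelyContinuousOnInterval.totalLengthFilter ⊓
      𝓟 (AbsolutelyContinuousOnInterval.disjWithin 0 b),
      E ∈ AbsolutelyContinuousOnInterval.disjWithin 0 b :=
    mem_inf_of_right (mem_principal_self _)
  filter_upwards [hmem] with E hE
  refine Finset.sum_le_sum fun i hi => ?_
  obtain ⟨h1, h2⟩ := hE.1 i hi
  have hsub : ∀ x ∈ uIcc 0 b, IntervalIntegrable g volume 0 x := fun x hx =>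
    hg.mono_set (uIcc_subset_uIcc_left hx)
  have i1 := hsub _ h1
  have i2 := hsub _ h2
  rw [dist_eq_norm, dist_eq_norm, intervalIntegral.integral_interval_sub_left i1 i2,
    intervalIntegral.integral_interval_sub_left i1.norm i2.norm, Real.norm_eq_abs]
  exact intervalIntegral.norm_integral_le_abs_integral_norm

theorem dr_intervalIntegral {g : ℝ → ℂ} (hg : ∀ b, 0 < b → IntervalIntegrable g volume 0 b)
    {u : ℝ → ℂ} (hu : ∀ r, 0 ≤ r → u r = ∫ t in 0..r, g t) : dr u =ᵐ[hl] g := by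
  have h1 : ∀ n : ℕ, ∀ᵐ r : ℝ, r ∈ uIcc 0 ((n : ℝ) + 1) → ∀ c ∈ uIcc 0 ((n : ℝ) + 1),
      HasDerivAt (fun x => ∫ t in c..x, g t) (g r) r := fun n =>
    (hg (n + 1) (by positivity)).ae_hasDerivAt_integral
  rw [hl, EventuallyEq, ae_restrict_iff' measurableSet_Ioi]
  filter_upwards [ae_all_iff.2 h1] with r hr hr0
  rw [mem_Ioi] at hr0
  obtain ⟨n, hn⟩ := exists_nat_gt r
  have h2 : HasDerivAt (fun x => ∫ t in (0 : ℝ)..x, g t) (g r) r := by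
    refine hr n ?_ 0 (by simp)
    rw [uIcc_of_le (by positivity)]
    exact ⟨hr0.le, by linarith⟩
  rw [dr_eq_deriv _ hr0]
  refine (h2.congr_of_eventuallyEq ?_).deriv
  filter_upwards [Ioi_mem_nhds hr0] with x hx using hu x (le_of_lt hx)

theorem MemH.eq_integral {u : ℝ → ℂ} (hu : MemH u) {r : ℝ} (hr : 0 ≤ r) :
    u r = ∫ t in 0..r, dr u t := by
  have hi := fun b (hb : (0 : ℝ) ≤ b) => intervalIntegrable_of_memLp hu.memLp_dr hb
  rcases hr.eq_or_lt with rfl | hr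
  · simpa using hu.zero_of_nonpos 0 le_rfl
  have hac := (hu.ac r hr).sub (ac_intervalIntegral (hi r hr.le))
  have hz : ∀ᵐ x, x ∈ uIcc 0 r → HasDerivAt (u - fun y => ∫ t in 0..y, dr u t) 0 x := by
    have h1 := hu.ae_differentiableAt
    rw [hl, ae_restrict_iff' measurableSet_Ioi] at h1
    filter_upwards [h1, (hi r hr.le).ae_hasDerivAt_integral, Measure.ae_ne volume (0 : ℝ)]
      with x h1 h2 hx0 hx
    have hxp : 0 < x := by
      rw [uIcc_of_le hr.le] at hx
      exact lt_of_le_of_ne hx.1 (Ne.symm hx0)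
    have h3 := (h1 hxp).hasDerivAt.sub (h2 hx 0 (by simp))
    rw [dr_eq_deriv _ hxp, sub_self] at h3
    exact h3
  obtain ⟨C, hC⟩ := hac.const_of_ae_hasDerivAt_zero hz
  have e0 := hC 0 (by simp)
  have er := hC r (by simp)
  simp only [Pi.sub_apply, intervalIntegral.integral_same, sub_zero,
    hu.zero_of_nonpos 0 le_rfl] at e0 er
  rw [← e0] at er
  exact sub_eq_zero.1 er

theorem eq_zero_of_derivL {u : H} (h : derivL u = 0) : u = 0 := by
  have h1 : dr u.fn =ᵐ[hl] 0 := (coeFn_derivL u).symm.trans (by rw [h]; exact Lp.coeFn_zero _ _ _)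
  rw [hl, EventuallyEq, ae_restrict_iff' measurableSet_Ioi] at h1
  ext r
  rcases le_or_gt r 0 with hr | hr
  · simpa using u.memH.zero_of_nonpos r hr
  · rw [u.memH.eq_integral hr.le, intervalIntegral.integral_zero_ae]
    · rfl
    · filter_upwards [h1] with t ht htr
      rw [uIoc_of_le hr.le] at htr
      exact ht htr.1

/-! ### The Hilbert space structure -/

/-- The scalar product on `ℋ` is the bracket `⟨·, ·⟩`. -/
@[reducible] def core : InnerProductSpace.Core ℂ H where
  inner u v := angle u.fn v.fn
  conj_inner_symm u v := by
    simp only [angle_eq, map_add, map_mul, inner_conj_symm, Complex.conj_ofNat]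
  re_inner_nonneg u := by
    rw [angle_self, RCLike.re_eq_complex_re, Complex.ofReal_re]
    positivity
  add_left u v w := by
    simp only [angle_eq, map_add, inner_add_left]
    ring
  smul_left u v c := by
    simp only [angle_eq, map_smul, inner_smul_left]
    ring
  definite u h := by
    change angle u.fn u.fn = 0 at h
    rw [angle_self] at h
    have h' : ‖derivL u‖ ^ 2 + 2 * ‖divL u‖ ^ 2 = 0 := Complex.ofReal_eq_zero.1 h
    refine eq_zero_of_derivL (norm_eq_zero.1 ?_)
    nlinarith [sq_nonneg ‖derivL u‖, sq_nonneg ‖divL u‖]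

instance : NormedAddCommGroup H := core.toNormedAddCommGroup
instance : InnerProductSpace ℂ H := InnerProductSpace.ofCore core.toCore

theorem inner_eq_angle (u v : H) : inner ℂ u v = angle u.fn v.fn := rfl

theorem norm_sq_eq (u : H) : ‖u‖ ^ 2 = ‖derivL u‖ ^ 2 + 2 * ‖divL u‖ ^ 2 := by
  rw [norm_sq_eq_re_inner (𝕜 := ℂ), inner_eq_angle, angle_self, RCLike.re_eq_complex_re,
    Complex.ofReal_re]

/-- A pair of limits of `u'` and `u / r` in `L²(0, ∞)` comes from an element of `ℋ`. -/
theorem exists_of_tendsto {u : ℕ → H} {g h : Lp ℂ 2 hl}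
    (hg : Tendsto (fun n => derivL (u n)) atTop (𝓝 g))
    (hh : Tendsto (fun n => divL (u n)) atTop (𝓝 h)) : ∃ w : H, derivL w = g ∧ divL w = h := by
  have gi := fun b (hb : (0 : ℝ) ≤ b) => intervalIntegrable_of_memLp (Lp.memLp g) hb
  set w : ℝ → ℂ := (Ioi 0).indicator fun r => ∫ t in 0..r, g t with hw
  have hw1 : ∀ r, 0 ≤ r → w r = ∫ t in 0..r, g t := by
    intro r hr
    rcases hr.eq_or_lt with rfl | hr
    · simp [hw]
    · simp [hw, indicator_of_mem (mem_Ioi.2 hr)]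
  -- pointwise convergence
  have hpt : ∀ r, 0 < r → Tendsto (fun n => (u n).fn r) atTop (𝓝 (w r)) := by
    intro r hr
    have hr' : Ioc 0 r ⊆ Ioi (0 : ℝ) := Ioc_subset_Ioi_self
    have hL1 : Tendsto (fun n => eLpNorm (fun t => dr (u n).fn t - g t) 1
        (volume.restrict (Ioc 0 r))) atTop (𝓝 0) := by
      have h2 : Tendsto (fun n => eLpNorm (fun t => dr (u n).fn t - g t) 2 hl) atTop (𝓝 0) := by
        have := (Lp.tendsto_Lp_iff_tendsto_eLpNorm' _ _).1 hg
        refine this.congr fun n => eLpNorm_congr_ae ?_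
        filter_upwards [coeFn_derivL (u n)] with t ht
        simp [ht]
      have h3 := ENNReal.Tendsto.mul_const (b := volume (Ioc 0 r) ^ (1 / 2 : ℝ)) h2
        (Or.inr (by simp : volume (Ioc 0 r) ^ (1 / 2 : ℝ) ≠ ⊤))
      rw [zero_mul] at h3
      refine tendsto_of_tendsto_of_tendsto_of_le_of_le tendsto_const_nhds h3 (fun _ => zero_le)
        fun n => ?_
      have hm : AEStronglyMeasurable (fun t => dr (u n).fn t - g t) hl :=
        (u n).memH.memLp_dr.1.sub (Lp.memLp g).1
      have h4 := eLpNorm_le_eLpNorm_mul_rpow_measure_univ (p := 1) (q := 2)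
        (f := fun t => dr (u n).fn t - g t)
        (μ := volume.restrict (Ioc 0 r)) (by norm_num)
        (hm.mono_measure (Measure.restrict_mono hr' le_rfl))
      refine h4.trans ?_
      rw [Measure.restrict_apply_univ]
      have e1 : (1 / ENNReal.toReal 1 - 1 / ENNReal.toReal 2 : ℝ) = 1 / 2 := by
        norm_num
      rw [e1]
      gcongr
      exact Measure.restrict_mono hr' le_rfl
    have := tendsto_integral_of_L1' (μ := volume.restrict (Ioc 0 r)) (fun t => g t)
      ((intervalIntegrable_iff_integrableOn_Ioc_of_le hr.le).1 (gi r hr.le)).1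
      (F := fun n t => dr (u n).fn t)
      (Eventually.of_forall fun n => (intervalIntegrable_iff_integrableOn_Ioc_of_le hr.le).1
        (intervalIntegrable_of_memLp (u n).memH.memLp_dr hr.le)) hL1
    rw [hw1 r hr.le, intervalIntegral.integral_of_le hr.le]
    refine this.congr fun n => ?_
    rw [(u n).memH.eq_integral hr.le, intervalIntegral.integral_of_le hr.le]
  -- the second limit is `w / r`
  have hdiv : (h : ℝ → ℂ) =ᵐ[hl] fun r : ℝ => w r / (r : ℂ) := by
    obtain ⟨ns, hns, hae⟩ := (tendstoInMeasure_of_tendsto_Lp hh).exists_seq_tendsto_ae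
    filter_upwards [hae, ae_all_iff.2 fun n => coeFn_divL (u n), ae_hl_pos] with r h1 h2 hr
    refine tendsto_nhds_unique h1 ?_
    simp only [h2]
    exact ((hpt r hr).comp hns.tendsto_atTop).div_const _
  have hd : dr w =ᵐ[hl] g := dr_intervalIntegral (fun b hb => gi b hb.le) hw1
  have hmem : MemH w :=
    { zero_of_nonpos := fun r hr => indicator_of_notMem (by simpa using hr) _
      ac := fun b hb => by
        have h1 := ac_intervalIntegral (gi b hb.le)
        refine h1.congr' ?_
        have hm : ∀ᶠ E in AbsolutelyContinuousOnInterval.totalLengthFilter ⊓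
            𝓟 (AbsolutelyContinuousOnInterval.disjWithin 0 b),
            E ∈ AbsolutelyContinuousOnInterval.disjWithin 0 b :=
          mem_inf_of_right (mem_principal_self _)
        filter_upwards [hm] with E hE
        refine Finset.sum_congr rfl fun i hi => ?_
        obtain ⟨h1, h2⟩ := hE.1 i hi
        rw [uIcc_of_le hb.le] at h1 h2
        rw [hw1 _ h1.1, hw1 _ h2.1]
      memLp_dr := (memLp_congr_ae hd).2 (Lp.memLp g)
      memLp_div := (memLp_congr_ae hdiv).1 (Lp.memLp h) }
  exact ⟨H.mk w hmem, Lp.ext ((coeFn_derivL _).trans hd),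
    Lp.ext ((coeFn_divL _).trans hdiv.symm)⟩

instance : CompleteSpace H := by
  refine UniformSpace.complete_of_cauchySeq_tendsto fun u hu => ?_
  have key : ∀ L : H →ₗ[ℂ] Lp ℂ 2 hl, (∀ v, ‖L v‖ ^ 2 ≤ ‖v‖ ^ 2) →
      CauchySeq fun n => L (u n) := by
    intro L hL
    have hLip : LipschitzWith 1 L := LipschitzWith.of_dist_le_mul fun x y => by
      rw [dist_eq_norm, dist_eq_norm, ← map_sub, NNReal.coe_one, one_mul]
      exact le_of_sq_le_sq (hL _) (norm_nonneg _)
    exact hu.map hLip.uniformContinuous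
  obtain ⟨g, hg⟩ := cauchySeq_tendsto_of_complete
    (key derivL fun v => by rw [norm_sq_eq]; nlinarith [sq_nonneg ‖divL v‖])
  obtain ⟨h, hh⟩ := cauchySeq_tendsto_of_complete
    (key divL fun v => by
      rw [norm_sq_eq]; nlinarith [sq_nonneg ‖divL v‖, sq_nonneg ‖derivL v‖])
  obtain ⟨w, rfl, rfl⟩ := exists_of_tendsto hg hh
  refine ⟨w, ?_⟩
  rw [tendsto_iff_norm_sub_tendsto_zero] at hg hh ⊢
  have h1 : Tendsto (fun n => ‖u n - w‖ ^ 2) atTop (𝓝 0) := by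
    have := (hg.pow 2).add ((hh.pow 2).const_mul 2)
    simp only [ne_eq, OfNat.ofNat_ne_zero, not_false_eq_true, zero_pow, mul_zero, add_zero] at this
    refine this.congr fun n => ?_
    rw [norm_sq_eq, map_sub, map_sub]
  have h2 := h1.sqrt
  simpa [Real.sqrt_sq (norm_nonneg _)] using h2

/-! ### The operators -/

/-- `u` is twice differentiable on `[0, ∞)`, with one-sided derivatives at `0`. -/
def TwiceDiff (u : ℝ → ℂ) : Prop :=
  DifferentiableOn ℝ u (Ici 0) ∧ DifferentiableOn ℝ (dr u) (Ici 0)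

/-- The differential operation `T u = -u'' + (2/r²) u` on the half-axis. -/
def T (u : ℝ → ℂ) : ℝ → ℂ :=
  (Ioi 0).indicator fun r => -dr (dr u) r + 2 / (r : ℂ) ^ 2 * u r

/-- `T` with the non-local addition: `T u - (2/r) u'(0)`. -/
def Tadd (u : ℝ → ℂ) : ℝ → ℂ :=
  (Ioi 0).indicator fun r => T u r - 2 / (r : ℂ) * dr u 0

theorem dr_add_on {u v : ℝ → ℂ} (hu : DifferentiableOn ℝ u (Ici 0))
    (hv : DifferentiableOn ℝ v (Ici 0)) {r : ℝ} (hr : 0 ≤ r) :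
    dr (u + v) r = dr u r + dr v r :=
  derivWithin_add (hu r hr) (hv r hr)

theorem dr_smul_on {u : ℝ → ℂ} (c : ℂ) (hu : DifferentiableOn ℝ u (Ici 0)) {r : ℝ} (hr : 0 ≤ r) :
    dr (c • u) r = c * dr u r :=
  derivWithin_const_smul c (hu r hr)

theorem dr_congr {u v : ℝ → ℂ} (h : EqOn u v (Ici 0)) {r : ℝ} (hr : 0 ≤ r) : dr u r = dr v r :=
  derivWithin_congr h (h hr)

theorem TwiceDiff.zero : TwiceDiff 0 := by
  have : dr 0 = 0 := funext fun r => congrFun (derivWithin_const (s := Ici (0 : ℝ)) (c := (0 : ℂ))) r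
  exact ⟨differentiableOn_const 0, by rw [this]; exact differentiableOn_const 0⟩

theorem TwiceDiff.add {u v : ℝ → ℂ} (hu : TwiceDiff u) (hv : TwiceDiff v) : TwiceDiff (u + v) :=
  ⟨hu.1.add hv.1, (hu.2.add hv.2).congr fun _ hr => dr_add_on hu.1 hv.1 hr⟩

theorem TwiceDiff.smul {u : ℝ → ℂ} (c : ℂ) (hu : TwiceDiff u) : TwiceDiff (c • u) :=
  ⟨hu.1.const_smul c, (hu.2.const_smul c).congr fun _ hr => dr_smul_on c hu.1 hr⟩

theorem TwiceDiff.dr_dr_add {u v : ℝ → ℂ} (hu : TwiceDiff u) (hv : TwiceDiff v) {r : ℝ}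
    (hr : 0 ≤ r) : dr (dr (u + v)) r = dr (dr u) r + dr (dr v) r := by
  rw [dr_congr (v := dr u + dr v) (fun x hx => dr_add_on hu.1 hv.1 hx) hr, dr_add_on hu.2 hv.2 hr]

theorem TwiceDiff.dr_dr_smul {u : ℝ → ℂ} (c : ℂ) (hu : TwiceDiff u) {r : ℝ} (hr : 0 ≤ r) :
    dr (dr (c • u)) r = c * dr (dr u) r := by
  rw [dr_congr (v := c • dr u) (fun x hx => dr_smul_on c hu.1 hx) hr, dr_smul_on c hu.2 hr]

theorem T_add {u v : ℝ → ℂ} (hu : TwiceDiff u) (hv : TwiceDiff v) : T (u + v) = T u + T v := by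
  funext r
  by_cases hr : r ∈ Ioi (0 : ℝ)
  · simp only [T, Pi.add_apply, indicator_of_mem hr, hu.dr_dr_add hv (mem_Ioi.1 hr).le]
    ring
  · simp [T, indicator_of_notMem hr]

theorem T_smul {u : ℝ → ℂ} (c : ℂ) (hu : TwiceDiff u) : T (c • u) = c • T u := by
  funext r
  by_cases hr : r ∈ Ioi (0 : ℝ)
  · simp only [T, Pi.smul_apply, smul_eq_mul, indicator_of_mem hr,
      hu.dr_dr_smul c (mem_Ioi.1 hr).le]
    ring
  · simp [T, indicator_of_notMem hr]

theorem Tadd_add {u v : ℝ → ℂ} (hu : TwiceDiff u) (hv : TwiceDiff v) :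
    Tadd (u + v) = Tadd u + Tadd v := by
  funext r
  by_cases hr : r ∈ Ioi (0 : ℝ)
  · simp only [Tadd, Pi.add_apply, indicator_of_mem hr, T_add hu hv,
      dr_add_on hu.1 hv.1 le_rfl]
    ring
  · simp [Tadd, indicator_of_notMem hr]

theorem Tadd_smul {u : ℝ → ℂ} (c : ℂ) (hu : TwiceDiff u) : Tadd (c • u) = c • Tadd u := by
  funext r
  by_cases hr : r ∈ Ioi (0 : ℝ)
  · simp only [Tadd, Pi.smul_apply, smul_eq_mul, indicator_of_mem hr, T_smul c hu,
      dr_smul_on c hu.1 le_rfl]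
    ring
  · simp [Tadd, indicator_of_notMem hr]

theorem T_zero : T 0 = 0 := by simpa using T_smul 0 TwiceDiff.zero

theorem Tadd_zero : Tadd 0 = 0 := by simpa using Tadd_smul 0 TwiceDiff.zero

theorem dr_zero (r : ℝ) : dr 0 r = 0 :=
  congrFun (derivWithin_const (s := Ici (0 : ℝ)) (c := (0 : ℂ))) r

theorem twiceDiff_of_smooth {u : ℝ → ℂ} (hu : ContDiffOn ℝ ∞ u (Ici 0)) : TwiceDiff u :=
  ⟨hu.differentiableOn (by simp),
    (((contDiffOn_infty_iff_derivWithin (uniqueDiffOn_Ici 0)).1 hu).2).differentiableOn (by simp)⟩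

/-- The initial domain `𝒲₀`: functions `u`, smooth on `[0, ∞)`, with `u ∈ ℋ`, `T u ∈ ℋ` and
`u''(0) = 0`. -/
def W0 : Submodule ℂ H where
  carrier := {u | ContDiffOn ℝ ∞ u.fn (Ici 0) ∧ MemH (T u.fn) ∧ dr (dr u.fn) 0 = 0}
  zero_mem' := ⟨contDiffOn_const, by rw [H.fn_zero, T_zero]; exact MemH.zero, by
    have : dr 0 = 0 := funext dr_zero
    rw [H.fn_zero, this, dr_zero]⟩
  add_mem' {u v} hu hv := by
    have hu' := twiceDiff_of_smooth hu.1
    have hv' := twiceDiff_of_smooth hv.1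
    refine ⟨hu.1.add hv.1, ?_, ?_⟩
    · rw [H.fn_add, T_add hu' hv']
      exact hu.2.1.add hv.2.1
    · rw [H.fn_add, hu'.dr_dr_add hv' le_rfl, hu.2.2, hv.2.2, add_zero]
  smul_mem' c u hu := by
    have hu' := twiceDiff_of_smooth hu.1
    refine ⟨hu.1.const_smul c, ?_, ?_⟩
    · rw [H.fn_smul, T_smul c hu']
      exact hu.2.1.smul c
    · rw [H.fn_smul, hu'.dr_dr_smul c le_rfl, hu.2.2, mul_zero]

/-- The operator `T̃`: the restriction of `T` to `𝒲₀`. -/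
def Ttilde : H →ₗ.[ℂ] H where
  domain := W0
  toFun :=
    { toFun := fun u => H.mk (T (u : H).fn) u.2.2.1
      map_add' := fun u v =>
        H.ext (T_add (twiceDiff_of_smooth u.2.1) (twiceDiff_of_smooth v.2.1))
      map_smul' := fun c u => H.ext (T_smul c (twiceDiff_of_smooth u.2.1)) }

/-- The domain `𝒲_κ`: functions `u ∈ ℋ`, twice differentiable on `[0, ∞)`, with
`T u - (2/r) u'(0) ∈ ℋ` and `3 u''(0) = 4 κ u'(0)`. -/
def W (κ : ℝ) : Submodule ℂ H where
  carrier := {u | TwiceDiff u.fn ∧ MemH (Tadd u.fn) ∧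
    3 * dr (dr u.fn) 0 = 4 * (κ : ℂ) * dr u.fn 0}
  zero_mem' := ⟨TwiceDiff.zero, by rw [H.fn_zero, Tadd_zero]; exact MemH.zero, by
    have : dr 0 = 0 := funext dr_zero
    rw [H.fn_zero, this, dr_zero, Pi.zero_apply, mul_zero, mul_zero]⟩
  add_mem' {u v} hu hv := by
    refine ⟨hu.1.add hv.1, ?_, ?_⟩
    · rw [H.fn_add, Tadd_add hu.1 hv.1]
      exact hu.2.1.add hv.2.1
    · rw [H.fn_add, hu.1.dr_dr_add hv.1 le_rfl, dr_add_on hu.1.1 hv.1.1 le_rfl, mul_add, mul_add,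
        hu.2.2, hv.2.2]
  smul_mem' c u hu := by
    refine ⟨hu.1.smul c, ?_, ?_⟩
    · rw [H.fn_smul, Tadd_smul c hu.1]
      exact hu.2.1.smul c
    · rw [H.fn_smul, hu.1.dr_dr_smul c le_rfl, dr_smul_on c hu.1.1 le_rfl]
      linear_combination c * hu.2.2

/-- The operator `T_κ u = T u - (2/r) u'(0)` on `𝒲_κ`. -/
def Tk (κ : ℝ) : H →ₗ.[ℂ] H where
  domain := W κ
  toFun :=
    { toFun := fun u => H.mk (Tadd (u : H).fn) u.2.2.1
      map_add' := fun u v => H.ext (Tadd_add u.2.1 v.2.1)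
      map_smul' := fun c u => H.ext (Tadd_smul c u.2.1) }

end RadialLaplace

/-!
The proof rests on the factorization `T = A* A` with `A u = u' + u / r` and `A* w = -w' + w / r`.
Since `(|u|² / r)' = 2 Re(conj(u) u') / r - |u|² / r²`, the scalar product of `ℋ` is
`⟨u, v⟩ = ∫ conj(A u) A v`, so `A` is an isometry of `ℋ` into `L²(0, ∞)` (`inner_factor`). Every
test function on `(0, ∞)` is `A u` for some `u ∈ 𝒲₀` (`exists_mem_W0`); hence `𝒲₀` is dense and
`A` is onto (`dense_W0`, `factor_surjective`).

Under `A` the operator `T` becomes `A A* = -d²/dr²`. In detail, let `h = A u`, `a = u'(0)` and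
`w = T u - (2/r) a`. Then `h' = -w + (h - 2 a) / r` and `h'' = -A w`, while at the origin
`h → 2 u'(0)` and `h' → (3/2) u''(0)`. The condition `3 u''(0) = 4 κ u'(0)` is thus the Robin
condition `h'(0) = κ h(0)`, and `T_κ` is unitarily equivalent to `-d²/dr²` with that condition.

* Symmetry of `T_κ` (`inner_Tk`): `⟨T_κ u, v⟩ - ⟨u, T_κ v⟩` is the integral of the derivative of the
  Wronskian of the two transformed functions. The Wronskian has limit zero at the origin by the
  Robin condition. At infinity it has a limit since its derivative is integrable, and the limit is
  zero since the Wronskian divided by `r` is integrable, unlike `1 / r` (`IsPrim.integral_hl`).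
* `T_κ + m²` is onto for `m > |κ|` (`exists_mem_W_Tadd_add`): the equation `-h'' + m² h = F` is
  solved in two steps, `-p' + m p = F` and `h' + m h = p`, where `h(0) = p(0) / (m + κ)` gives the
  Robin condition. Square integrability of the solutions is the Schur test for the kernel
  `exp(-m |r - t|)`. As `p` is continuous, `h` is differentiable everywhere, and then `u = A⁻¹ h` is
  twice differentiable on `[0, ∞)` (`twiceDiff_fn`).

A densely defined symmetric operator with `T_κ + m²` onto is self-adjoint
(`LinearPMap.isSelfAdjoint_of_surjective_add`). Finally `T u ∈ ℋ` with `u` smooth forces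
`u'(0) = 0`, so `T_κ` extends the restriction of `T` to `𝒲₀` (`Ttilde_le_Tk`).
-/

namespace RadialLaplace

/-! ### Locally absolutely continuous functions on the open half-axis -/

/-- `f` is locally absolutely continuous on `(0, ∞)` and `f'` is its derivative almost everywhere.
No integrability of `f'` and no behaviour of `f` at `0` is asked for. -/
structure IsPrim (f f' : ℝ → ℂ) : Prop where
  ac : ∀ a b, 0 < a → a ≤ b → AbsolutelyContinuousOnInterval f a b
  hasDerivAt : ∀ᵐ r ∂hl, HasDerivAt f (f' r) r

theorem ac_congr {f g : ℝ → ℂ} {a b : ℝ} (hf : AbsolutelyContinuousOnInterval f a b)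
    (h : ∀ x ∈ uIcc a b, ∀ y ∈ uIcc a b, dist (f x) (f y) = dist (g x) (g y)) :
    AbsolutelyContinuousOnInterval g a b := by
  refine Tendsto.congr' ?_ hf
  have hm : ∀ᶠ E in AbsolutelyContinuousOnInterval.totalLengthFilter ⊓
      𝓟 (AbsolutelyContinuousOnInterval.disjWithin a b),
      E ∈ AbsolutelyContinuousOnInterval.disjWithin a b :=
    mem_inf_of_right (mem_principal_self _)
  filter_upwards [hm] with E hE
  exact Finset.sum_congr rfl fun i hi => h _ (hE.1 i hi).1 _ (hE.1 i hi).2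

namespace IsPrim

variable {f f' g g' : ℝ → ℂ}

theorem add (hf : IsPrim f f') (hg : IsPrim g g') :
    IsPrim (fun r => f r + g r) (fun r => f' r + g' r) where
  ac a b ha hab := (hf.ac a b ha hab).add (hg.ac a b ha hab)
  hasDerivAt := by
    filter_upwards [hf.hasDerivAt, hg.hasDerivAt] with r h1 h2 using h1.add h2

theorem sub (hf : IsPrim f f') (hg : IsPrim g g') :
    IsPrim (fun r => f r - g r) (fun r => f' r - g' r) where
  ac a b ha hab := (hf.ac a b ha hab).sub (hg.ac a b ha hab)
  hasDerivAt := by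
    filter_upwards [hf.hasDerivAt, hg.hasDerivAt] with r h1 h2 using h1.sub h2

theorem mul (hf : IsPrim f f') (hg : IsPrim g g') :
    IsPrim (fun r => f r * g r) (fun r => f' r * g r + f r * g' r) where
  ac a b ha hab := (hf.ac a b ha hab).smul (hg.ac a b ha hab)
  hasDerivAt := by
    filter_upwards [hf.hasDerivAt, hg.hasDerivAt] with r h1 h2 using h1.mul h2

theorem star (hf : IsPrim f f') : IsPrim (fun r => conj (f r)) (fun r => conj (f' r)) where
  ac a b ha hab := ac_congr (hf.ac a b ha hab) fun x _ y _ => by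
    rw [dist_eq_norm, dist_eq_norm, ← map_sub, RCLike.norm_conj]
  hasDerivAt := by
    filter_upwards [hf.hasDerivAt] with r h1
    exact h1.star

theorem congr (hf : IsPrim f f') (h : EqOn f g (Ioi 0)) (h' : f' =ᵐ[hl] g') : IsPrim g g' where
  ac a b ha hab := ac_congr (hf.ac a b ha hab) fun x hx y hy => by
    rw [uIcc_of_le hab] at hx hy
    rw [h (mem_Ioi.2 (ha.trans_le hx.1)), h (mem_Ioi.2 (ha.trans_le hy.1))]
  hasDerivAt := by
    filter_upwards [hf.hasDerivAt, h', ae_hl_pos] with r h1 h2 hr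
    rw [← h2]
    refine h1.congr_of_eventuallyEq ?_
    filter_upwards [Ioi_mem_nhds hr] with x hx using (h hx).symm

theorem of_hasDerivAt (h : ∀ r, 0 < r → HasDerivAt f (f' r) r) (hc : ContinuousOn f' (Ioi 0)) :
    IsPrim f f' where
  ac a b ha hab := by
    have hsub : uIcc a b ⊆ Ioi 0 := by
      rw [uIcc_of_le hab]
      exact fun x hx => ha.trans_le hx.1
    obtain ⟨C, hC⟩ := isCompact_uIcc.exists_bound_of_continuousOn (hc.mono hsub)
    have : LipschitzOnWith C.toNNReal f (uIcc a b) :=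
      (convex_uIcc a b).lipschitzOnWith_of_nnnorm_hasDerivWithin_le
        (fun x hx => (h x (hsub hx)).hasDerivWithinAt) fun x hx => by
          rw [← NNReal.coe_le_coe, coe_nnnorm]
          exact (hC x hx).trans (Real.le_coe_toNNReal C)
    exact this.absolutelyContinuousOnInterval
  hasDerivAt := by
    filter_upwards [ae_hl_pos] with r hr using h r hr

theorem of_memH {u : ℝ → ℂ} (hu : MemH u) : IsPrim u (dr u) where
  ac a b ha hab := (hu.ac b (ha.trans_le hab)).mono <| by
    rw [uIcc_of_le hab, uIcc_of_le (ha.le.trans hab)]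
    exact Icc_subset_Icc_left ha.le
  hasDerivAt := by
    filter_upwards [hu.ae_differentiableAt, ae_hl_pos] with r h1 hr
    rw [dr_eq_deriv _ hr]
    exact h1.hasDerivAt

theorem const (c : ℂ) : IsPrim (fun _ => c) (fun _ => 0) :=
  of_hasDerivAt (fun r _ => hasDerivAt_const r c) continuousOn_const

theorem ofReal : IsPrim (fun r => (r : ℂ)) (fun _ => 1) :=
  of_hasDerivAt (fun r _ => (hasDerivAt_id r).ofReal_comp) continuousOn_const

theorem inv : IsPrim (fun r => ((r : ℂ))⁻¹) (fun r => -((r : ℂ) ^ 2)⁻¹) := by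
  refine of_hasDerivAt (fun r hr => ?_) ?_
  · have hr' : (r : ℂ) ≠ 0 := by exact_mod_cast hr.ne'
    have := ((hasDerivAt_id r).ofReal_comp).inv hr'
    refine this.congr_deriv ?_
    simp [neg_div]
  · refine ContinuousOn.neg (ContinuousOn.inv₀ (by fun_prop) fun r hr => ?_)
    have : (r : ℂ) ≠ 0 := by exact_mod_cast (ne_of_gt (mem_Ioi.1 hr))
    positivity

theorem of_integral (hg : ∀ b, 0 < b → IntervalIntegrable g volume 0 b) :
    IsPrim (fun r => ∫ t in 0..r, g t) g where
  ac a b ha hab := (ac_intervalIntegral (hg b (ha.trans_le hab))).mono <| by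
    rw [uIcc_of_le hab, uIcc_of_le (ha.le.trans hab)]
    exact Icc_subset_Icc_left ha.le
  hasDerivAt := by
    have h1 : ∀ n : ℕ, ∀ᵐ r : ℝ, r ∈ uIcc 0 ((n : ℝ) + 1) → ∀ c ∈ uIcc 0 ((n : ℝ) + 1),
        HasDerivAt (fun x => ∫ t in c..x, g t) (g r) r := fun n =>
      (hg (n + 1) (by positivity)).ae_hasDerivAt_integral
    rw [hl, ae_restrict_iff' measurableSet_Ioi]
    filter_upwards [ae_all_iff.2 h1] with r hr hr0
    rw [mem_Ioi] at hr0
    obtain ⟨n, hn⟩ := exists_nat_gt r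
    refine hr n ?_ 0 (by simp)
    rw [uIcc_of_le (by positivity)]
    exact ⟨hr0.le, by linarith⟩

theorem continuousOn (hf : IsPrim f f') : ContinuousOn f (Ioi 0) := by
  intro r hr
  rw [mem_Ioi] at hr
  have h := (hf.ac (r / 2) (r + 1) (by positivity) (by linarith)).continuousOn
  rw [uIcc_of_le (by linarith)] at h
  exact (h.continuousAt (Icc_mem_nhds (by linarith) (by linarith))).continuousWithinAt

theorem eq_of_hasDerivAt_zero (hf : IsPrim f f') {a b : ℝ} (ha : 0 < a) (hab : a ≤ b)
    (h0 : ∀ᵐ r, r ∈ Ioc a b → f' r = 0) : f a = f b := by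
  have h1 := hf.hasDerivAt
  rw [hl, ae_restrict_iff' measurableSet_Ioi] at h1
  obtain ⟨C, hC⟩ := (hf.ac a b ha hab).const_of_ae_hasDerivAt_zero <| by
    filter_upwards [h1, h0, Measure.ae_ne volume a] with x h1 h0 hxa hx
    rw [uIcc_of_le hab] at hx
    rw [← h0 ⟨lt_of_le_of_ne hx.1 hxa.symm, hx.2⟩]
    exact h1 (ha.trans_le hx.1)
  rw [hC a (by simp), hC b (by simp)]

/-- The fundamental theorem of calculus. -/
theorem integral_eq (hf : IsPrim f f') {a b : ℝ} (ha : 0 < a) (hab : a ≤ b)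
    (hi : IntegrableOn f' (Ioc a b)) : ∫ t in a..b, f' t = f b - f a := by
  have hg : Integrable ((Ioc a b).indicator f') := hi.integrable_indicator measurableSet_Ioc
  have hG := hf.sub (of_integral fun b _ => hg.intervalIntegrable (a := 0) (b := b))
  have h := hG.eq_of_hasDerivAt_zero ha hab <| Eventually.of_forall fun r hr => by
    rw [indicator_of_mem hr, sub_self]
  have h2 : (∫ t in 0..b, (Ioc a b).indicator f' t) - ∫ t in 0..a, (Ioc a b).indicator f' t
      = ∫ t in a..b, f' t := by
    rw [intervalIntegral.integral_interval_sub_left hg.intervalIntegrable hg.intervalIntegrable,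
      intervalIntegral.integral_of_le hab, intervalIntegral.integral_of_le hab]
    exact setIntegral_congr_fun measurableSet_Ioc fun t ht => indicator_of_mem ht _
  rw [← h2]
  linear_combination h

/-- Two primitives of one function with the same limit at `0` agree. -/
theorem eqOn_of_tendsto (hf : IsPrim f f') (hg : IsPrim g f') {L : ℂ}
    (hf0 : Tendsto f (𝓝[>] 0) (𝓝 L)) (hg0 : Tendsto g (𝓝[>] 0) (𝓝 L)) :
    EqOn f g (Ioi 0) := by
  intro r hr
  rw [mem_Ioi] at hr
  have h := hf.sub hg
  have h1 : Tendsto (fun x => f x - g x) (𝓝[>] 0) (𝓝 0) := by simpa using hf0.sub hg0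
  have h2 : Tendsto (fun x => f x - g x) (𝓝[>] 0) (𝓝 (f r - g r)) := by
    refine tendsto_const_nhds.congr' ?_
    filter_upwards [Ioo_mem_nhdsGT hr] with x hx
    exact (h.eq_of_hasDerivAt_zero hx.1 hx.2.le (by simp)).symm
  exact sub_eq_zero.1 (tendsto_nhds_unique h2 h1)

end IsPrim

/-! ### Boundary values -/

/-- Since `1 / r` is not integrable at infinity, a limit of `g` there is zero if `g / r` is
integrable. -/
theorem eq_zero_of_tendsto_atTop_of_integrableOn_div {g : ℝ → ℂ} {L : ℂ}
    (hg : Tendsto g atTop (𝓝 L)) (hi : IntegrableOn (fun r : ℝ => g r / (r : ℂ)) (Ioi 1)) :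
    L = 0 := by
  by_contra hL
  have hL' : 0 < ‖L‖ := norm_pos_iff.2 hL
  obtain ⟨R, hR⟩ := eventually_atTop.1 <|
    (hg.norm.eventually (lt_mem_nhds (half_lt_self hL'))).and (eventually_ge_atTop 1)
  refine not_integrableOn_Ioi_inv (a := R) ?_
  refine Integrable.mono' (g := fun r => 2 / ‖L‖ * ‖g r / (r : ℂ)‖) ?_
    (by fun_prop) ?_
  · exact ((hi.mono_set (Ioi_subset_Ioi (hR R le_rfl).2)).norm).const_mul _
  · filter_upwards [ae_restrict_mem measurableSet_Ioi] with r hr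
    obtain ⟨h1, h2⟩ := hR r (le_of_lt hr)
    have hr0 : 0 < r := by linarith
    rw [norm_div, Complex.norm_real, Real.norm_of_nonneg hr0.le,
      Real.norm_of_nonneg (inv_nonneg.2 hr0.le), inv_eq_one_div]
    rw [← mul_div_assoc]
    gcongr
    rw [div_mul_eq_mul_div, le_div_iff₀ hL']
    linarith

/-- Since `1 / r` is not integrable at the origin, a limit of `g` there is zero if `g / r` is
integrable. -/
theorem eq_zero_of_tendsto_zero_of_integrableOn_div {g : ℝ → ℂ} {L : ℂ}
    (hg : Tendsto g (𝓝[>] 0) (𝓝 L))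
    (hi : IntegrableOn (fun r : ℝ => g r / (r : ℂ)) (Ioi 0)) : L = 0 := by
  by_contra hL
  have hL' : 0 < ‖L‖ := norm_pos_iff.2 hL
  obtain ⟨δ, hδ, hR⟩ := (mem_nhdsGT_iff_exists_Ioc_subset).1
    (hg.norm.eventually (lt_mem_nhds (half_lt_self hL')))
  rw [mem_Ioi] at hδ
  have : ¬ IntervalIntegrable (fun x : ℝ => x⁻¹) volume 0 δ := by
    simp [hδ.ne]
  refine this ?_
  rw [intervalIntegrable_iff_integrableOn_Ioc_of_le hδ.le]
  refine Integrable.mono' (g := fun r => 2 / ‖L‖ * ‖g r / (r : ℂ)‖) ?_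
    (by fun_prop) ?_
  · exact ((hi.mono_set Ioc_subset_Ioi_self).norm).const_mul _
  · filter_upwards [ae_restrict_mem measurableSet_Ioc] with r hr
    have h1 : ‖L‖ / 2 < ‖g r‖ := hR hr
    have hr0 : 0 < r := hr.1
    rw [norm_div, Complex.norm_real, Real.norm_of_nonneg hr0.le,
      Real.norm_of_nonneg (inv_nonneg.2 hr0.le), inv_eq_one_div]
    rw [← mul_div_assoc]
    gcongr
    rw [div_mul_eq_mul_div, le_div_iff₀ hL']
    linarith

theorem IsPrim.tendsto_atTop {g g' : ℝ → ℂ} (hg : IsPrim g g') (hi : Integrable g' hl) :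
    Tendsto g atTop (𝓝 (g 1 + ∫ t in Ioi 1, g' t)) := by
  have hi1 : IntegrableOn g' (Ioi 1) :=
    IntegrableOn.mono_set (t := Ioi 0) hi (Ioi_subset_Ioi zero_le_one)
  refine ((intervalIntegral_tendsto_integral_Ioi 1 hi1 tendsto_id).const_add (g 1)).congr' ?_
  filter_upwards [eventually_ge_atTop 1] with r hr
  rw [id, hg.integral_eq one_pos hr (hi1.mono_set Ioc_subset_Ioi_self)]
  ring

theorem IsPrim.tendsto_zero {g g' : ℝ → ℂ} (hg : IsPrim g g') (hi : Integrable g' hl) :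
    Tendsto g (𝓝[>] 0) (𝓝 (g 1 - ∫ t in Ioc 0 1, g' t)) := by
  have hi' : Integrable ((Ioi 0).indicator g') :=
    IntegrableOn.integrable_indicator (s := Ioi 0) hi measurableSet_Ioi
  have hc := intervalIntegral.continuous_primitive (μ := volume)
    (fun a b => hi'.intervalIntegrable (a := a) (b := b)) 1
  have h0 := (hc.tendsto 0).mono_left (nhdsWithin_le_nhds (s := Ioi 0))
  have h1 := h0.const_add (g 1)
  have e : g 1 + ∫ t in (1 : ℝ)..0, (Ioi 0).indicator g' t = g 1 - ∫ t in Ioc 0 1, g' t := by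
    rw [intervalIntegral.integral_symm, intervalIntegral.integral_of_le zero_le_one,
      ← sub_eq_add_neg]
    congr 1
    exact setIntegral_congr_fun measurableSet_Ioc fun t ht => indicator_of_mem ht.1 _
  rw [e] at h1
  refine h1.congr' ?_
  filter_upwards [Ioc_mem_nhdsGT one_pos] with r hr
  have h2 := hg.integral_eq hr.1 hr.2
    (IntegrableOn.mono_set (t := Ioi 0) hi fun x hx => hr.1.trans hx.1)
  rw [intervalIntegral.integral_symm]
  have h3 : ∫ t in r..1, (Ioi 0).indicator g' t = ∫ t in r..1, g' t := by
    refine intervalIntegral.integral_congr_ae (Eventually.of_forall fun t ht => ?_)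
    rw [uIoc_of_le hr.2] at ht
    exact indicator_of_mem (hr.1.trans ht.1) _
  rw [h3, h2]
  ring

/-- If `g'` is integrable on `(0, ∞)` and `g / r` is integrable at infinity, then `g` vanishes at
infinity, because `1 / r` is not integrable there. -/
theorem IsPrim.integral_hl {g g' : ℝ → ℂ} (hg : IsPrim g g') (hi : Integrable g' hl)
    (hd : IntegrableOn (fun r : ℝ => g r / (r : ℂ)) (Ioi 1)) {L : ℂ}
    (h0 : Tendsto g (𝓝[>] 0) (𝓝 L)) : ∫ t, g' t ∂hl = -L := by
  have h1 := eq_zero_of_tendsto_atTop_of_integrableOn_div (hg.tendsto_atTop hi) hd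
  have h2 := tendsto_nhds_unique h0 (hg.tendsto_zero hi)
  have hi' : IntegrableOn g' (Ioi 0) := hi
  have h3 : ∫ t, g' t ∂hl = (∫ t in Ioc 0 1, g' t) + ∫ t in Ioi 1, g' t := by
    rw [hl, ← Ioc_union_Ioi_eq_Ioi zero_le_one, setIntegral_union Ioc_disjoint_Ioi_same
      measurableSet_Ioi (hi'.mono_set Ioc_subset_Ioi_self)
      (hi'.mono_set (Ioi_subset_Ioi zero_le_one))]
  rw [h3, h2]
  linear_combination h1

theorem IsPrim.integral_hl_eq_zero {g g' : ℝ → ℂ} (hg : IsPrim g g') (hi : Integrable g' hl)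
    (hd : Integrable (fun r : ℝ => g r / (r : ℂ)) hl) : ∫ t, g' t ∂hl = 0 := by
  have hd' : IntegrableOn (fun r : ℝ => g r / (r : ℂ)) (Ioi 0) := hd
  have h0 := eq_zero_of_tendsto_zero_of_integrableOn_div (hg.tendsto_zero hi) hd
  rw [hg.integral_hl hi (hd'.mono_set (Ioi_subset_Ioi zero_le_one)) (hg.tendsto_zero hi), h0,
    neg_zero]

/-! ### The isometry `u ↦ u' + u / r` -/

/-- The first-order factor `u ↦ u' + u / r` of `T`, as a map from `ℋ` into `L²(0, ∞)`. -/
def factor : H →ₗ[ℂ] Lp ℂ 2 hl := derivL + divL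

theorem coeFn_factor (u : H) :
    factor u =ᵐ[hl] fun r : ℝ => dr u.fn r + u.fn r / (r : ℂ) := by
  filter_upwards [coeFn_derivL u, coeFn_divL u, Lp.coeFn_add (derivL u) (divL u)] with r h1 h2 h3
  change (derivL u + divL u : Lp ℂ 2 hl) r = _
  rw [h3, Pi.add_apply, h1, h2]

/-- The cross terms `∫ (conj(u) v)' / r` equal `∫ conj(u) v / r²`, the boundary terms of
`conj(u) v / r` being zero. -/
theorem inner_factor (u v : H) : inner ℂ (factor u) (factor v) = inner ℂ u v := by
  have hp := ((IsPrim.of_memH u.memH).star.mul (IsPrim.of_memH v.memH)).mul IsPrim.inv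
  have i1 := L2.integrable_inner (𝕜 := ℂ) (derivL u) (divL v)
  have i2 := L2.integrable_inner (𝕜 := ℂ) (divL u) (derivL v)
  have i3 := L2.integrable_inner (𝕜 := ℂ) (divL u) (divL v)
  have e : (fun r => inner ℂ (derivL u r) (divL v r) + inner ℂ (divL u r) (derivL v r)
      - inner ℂ (divL u r) (divL v r)) =ᵐ[hl] fun r : ℝ =>
      (conj (dr u.fn r) * v.fn r + conj (u.fn r) * dr v.fn r) * (r : ℂ)⁻¹
        + conj (u.fn r) * v.fn r * -((r : ℂ) ^ 2)⁻¹ := by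
    filter_upwards [coeFn_derivL u, coeFn_derivL v, coeFn_divL u, coeFn_divL v, ae_hl_pos]
      with r h1 h2 h3 h4 hr
    have hr' : (r : ℂ) ≠ 0 := by exact_mod_cast hr.ne'
    rw [h1, h2, h3, h4]
    simp only [RCLike.inner_apply, map_div₀, Complex.conj_ofReal]
    field_simp
    ring
  have hd : Integrable (fun r : ℝ => conj (u.fn r) * v.fn r * (r : ℂ)⁻¹ / (r : ℂ)) hl := by
    refine i3.congr ?_
    filter_upwards [coeFn_divL u, coeFn_divL v, ae_hl_pos] with r h3 h4 hr
    have hr' : (r : ℂ) ≠ 0 := by exact_mod_cast hr.ne'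
    rw [h3, h4]
    simp only [RCLike.inner_apply, map_div₀, Complex.conj_ofReal]
    field_simp
  have h0 := hp.integral_hl_eq_zero (((i1.add i2).sub i3).congr e) hd
  have i12 : Integrable (fun r => inner ℂ (derivL u r) (divL v r)
      + inner ℂ (divL u r) (derivL v r)) hl := i1.add i2
  rw [← integral_congr_ae e, integral_sub i12 i3, integral_add i1 i2, ← L2.inner_def,
    ← L2.inner_def, ← L2.inner_def] at h0
  rw [inner_eq_angle, angle_eq, factor, LinearMap.add_apply, LinearMap.add_apply, inner_add_left,
    inner_add_right, inner_add_right]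
  linear_combination h0

/-- `factor` as a linear isometry. -/
def factorI : H →ₗᵢ[ℂ] Lp ℂ 2 hl := factor.isometryOfInner inner_factor

theorem factor_injective : Function.Injective factor := factorI.injective

/-! ### Preimages of test functions -/

/-- A function that vanishes near the origin and decays like `1 / r` is square integrable. -/
theorem memLp_two_of_norm_le {f : ℝ → ℂ} (hf : AEStronglyMeasurable f hl) {ε C : ℝ} (hε : 0 < ε)
    (h0 : ∀ r, r < ε → f r = 0) (hC : ∀ r, 0 < r → ‖f r‖ ≤ C / r) : MemLp f 2 hl := by
  have hs : MeasurableSet (Ici ε) := measurableSet_Ici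
  have hg : MemLp ((Ici ε).indicator fun r : ℝ => C * r⁻¹) 2 hl := by
    rw [memLp_indicator_iff_restrict hs, memLp_two_iff_integrable_sq
      (by fun_prop)]
    have h1 : IntegrableOn (fun r : ℝ => C ^ 2 * r ^ (-2 : ℝ)) (Ioi (ε / 2)) :=
      (integrableOn_Ioi_rpow_of_lt (by norm_num) (by positivity)).const_mul _
    have h2 : (hl.restrict (Ici ε)) ≤ volume.restrict (Ioi (ε / 2)) := by
      rw [hl, Measure.restrict_restrict hs]
      refine Measure.restrict_mono (fun x hx => ?_) le_rfl
      have := mem_Ici.1 hx.1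
      exact mem_Ioi.2 (by linarith)
    refine (Integrable.mono_measure h1 h2).congr ?_
    filter_upwards [ae_restrict_mem hs] with r hr
    have hr0 : 0 < r := hε.trans_le hr
    rw [Real.rpow_neg hr0.le, mul_pow, inv_pow]
    norm_num
  refine hg.mono hf ?_
  filter_upwards [ae_hl_pos] with r hr
  by_cases hre : r < ε
  · rw [h0 r hre, norm_zero]
    exact norm_nonneg _
  · rw [indicator_of_mem (mem_Ici.2 (not_lt.1 hre)), ← div_eq_mul_inv]
    exact (hC r hr).trans (le_abs_self _)

theorem memH_of_contDiff {v : ℝ → ℂ} (hv : ContDiff ℝ 1 v) {ε C : ℝ} (hε : 0 < ε)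
    (h0 : ∀ r, r < ε → v r = 0) (hC : ∀ r, ‖v r‖ ≤ C) (hd : ∀ r, 0 < r → ‖deriv v r‖ ≤ C / r) :
    MemH v where
  zero_of_nonpos r hr := h0 r (hr.trans_lt hε)
  ac b _ := hv.contDiffOn.absolutelyContinuousOnInterval
  memLp_dr := by
    have h1 : dr v =ᵐ[hl] deriv v := by
      filter_upwards [ae_hl_pos] with r hr using dr_eq_deriv v hr
    refine (memLp_congr_ae h1).2 ?_
    refine memLp_two_of_norm_le (hv.continuous_deriv le_rfl).aestronglyMeasurable hε
      (fun r hr => ?_) hd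
    have : v =ᶠ[𝓝 r] fun _ => 0 := by
      filter_upwards [Iio_mem_nhds hr] with x hx using h0 x hx
    rw [this.deriv_eq, deriv_const]
  memLp_div := by
    refine memLp_two_of_norm_le (C := C) ?_ hε (fun r hr => ?_) fun r hr => ?_
    · exact (hv.continuous.measurable.div Complex.measurable_ofReal).aestronglyMeasurable
    · rw [h0 r hr, zero_div]
    · rw [norm_div, Complex.norm_real, Real.norm_of_nonneg hr.le]
      gcongr
      exact hC r

theorem memH_of_hasCompactSupport {v : ℝ → ℂ} (hv : ContDiff ℝ 1 v) (hs : HasCompactSupport v)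
    {ε : ℝ} (hε : 0 < ε) (h0 : ∀ r, r < ε → v r = 0) : MemH v := by
  have hcd := hv.continuous_deriv le_rfl
  obtain ⟨C1, hC1⟩ := hs.exists_bound_of_continuous hv.continuous
  obtain ⟨C2, hC2⟩ := (hs.deriv.mul_left (f := fun r : ℝ => (r : ℂ))).exists_bound_of_continuous
    (Complex.continuous_ofReal.mul hcd)
  refine memH_of_contDiff (C := max C1 C2) hv hε h0 (fun r => (hC1 r).trans (le_max_left _ _))
    fun r hr => ?_
  have h := (hC2 r).trans (le_max_right C1 C2)
  simp only [Pi.mul_apply, norm_mul, Complex.norm_real, Real.norm_of_nonneg hr.le] at h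
  rw [le_div_iff₀ hr]
  linarith

theorem dr_eq_deriv_of_differentiable {u : ℝ → ℂ} (hu : Differentiable ℝ u) {r : ℝ} (hr : 0 ≤ r) :
    dr u r = deriv u r :=
  (hu r).derivWithin (uniqueDiffOn_Ici 0 r hr)

/-- Every test function `φ` on `(0, ∞)` is `u' + u / r` for some `u ∈ 𝒲₀`, namely
`u(r) = (1/r) ∫₀^r t φ(t) dt`, for which `T u = -φ' + φ / r` is again a test function. -/
theorem exists_mem_W0 {φ : ℝ → ℂ} (hφ : ContDiff ℝ ∞ φ) (hs : HasCompactSupport φ) {ε : ℝ}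
    (hε : 0 < ε) (h0 : ∀ r, r < ε → φ r = 0) :
    ∃ u ∈ W0, ∀ r, 0 < r → dr u.fn r + u.fn r / (r : ℂ) = φ r := by
  have hid : ContDiff ℝ ∞ (fun r : ℝ => (r : ℂ)) := Complex.ofRealCLM.contDiff
  have hrφ : ContDiff ℝ ∞ (fun r : ℝ => (r : ℂ) * φ r) := hid.mul hφ
  have hrs : HasCompactSupport (fun r : ℝ => (r : ℂ) * φ r) := hs.mul_left
  set U : ℝ → ℂ := fun r => ∫ t in 0..r, (t : ℂ) * φ t with hU
  have hUd : ∀ r : ℝ, HasDerivAt U ((r : ℂ) * φ r) r := fun r =>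
    intervalIntegral.integral_hasDerivAt_right (hrφ.continuous.intervalIntegrable _ _)
      (hrφ.continuous.stronglyMeasurableAtFilter _ _) hrφ.continuous.continuousAt
  have hUs : ContDiff ℝ ∞ U := by
    refine contDiff_infty_iff_deriv.2 ⟨fun r => (hUd r).differentiableAt, ?_⟩
    rw [show deriv U = fun r : ℝ => (r : ℂ) * φ r from funext fun r => (hUd r).deriv]
    exact hrφ
  have hU0 : ∀ r, r < ε → U r = 0 := by
    intro r hr
    refine intervalIntegral.integral_zero_ae (Eventually.of_forall fun t ht => ?_)
    have : t < ε := by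
      rcases mem_uIoc.1 ht with h | h
      · exact h.2.trans_lt hr
      · exact h.2.trans_lt hε
    rw [h0 t this, mul_zero]
  obtain ⟨C1, hC1⟩ : ∃ C, ∀ r, ‖U r‖ ≤ C := by
    have hi : Integrable (fun r : ℝ => ‖(r : ℂ) * φ r‖) :=
      (hrφ.continuous.integrable_of_hasCompactSupport hrs).norm
    refine ⟨∫ t : ℝ, ‖(t : ℂ) * φ t‖, fun r => ?_⟩
    refine intervalIntegral.norm_integral_le_integral_norm_uIoc.trans ?_
    exact setIntegral_le_integral hi (Eventually.of_forall fun _ => norm_nonneg _)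
  obtain ⟨C2, hC2⟩ := hrs.exists_bound_of_continuous hrφ.continuous
  have hC1' : 0 ≤ C1 := (norm_nonneg _).trans (hC1 0)
  have hC2' : 0 ≤ C2 := (norm_nonneg _).trans (hC2 0)
  set u : ℝ → ℂ := fun r => U r / (r : ℂ) with hu
  have hu0 : ∀ r, r < ε → u r = 0 := fun r hr => by simp only [hu, hU0 r hr, zero_div]
  have hus : ContDiff ℝ ∞ u := by
    refine contDiff_iff_contDiffAt.2 fun r => ?_
    rcases lt_or_ge r ε with hr | hr
    · refine (contDiffAt_const (c := (0 : ℂ))).congr_of_eventuallyEq ?_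
      filter_upwards [Iio_mem_nhds hr] with x hx using hu0 x hx
    · simp only [hu, div_eq_mul_inv]
      refine hUs.contDiffAt.mul (hid.contDiffAt.inv ?_)
      exact_mod_cast (hε.trans_le hr).ne'
  have hud : ∀ r, 0 < r → HasDerivAt u (φ r - U r / (r : ℂ) ^ 2) r := by
    intro r hr
    have hr' : (r : ℂ) ≠ 0 := by exact_mod_cast hr.ne'
    refine ((hUd r).div (hasDerivAt_id r).ofReal_comp hr').congr_deriv ?_
    simp only [id, Complex.ofReal_one]
    field_simp
  have hdd : ∀ r, 0 ≤ r → dr u r = deriv u r := fun r hr =>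
    dr_eq_deriv_of_differentiable (hus.differentiable (by simp)) hr
  have huH : MemH u := by
    refine memH_of_contDiff (hus.of_le (by simp)) hε hu0 (C := C1 / ε + C2)
      (fun r => ?_) fun r hr => ?_
    · rcases lt_or_ge r ε with hr | hr
      · rw [hu0 r hr, norm_zero]
        positivity
      · have hr0 := hε.trans_le hr
        simp only [hu, norm_div, Complex.norm_real, Real.norm_of_nonneg hr0.le]
        have : ‖U r‖ / r ≤ C1 / ε := by
          gcongr
          exact hC1 r
        linarith
    · rw [(hud r hr).deriv, le_div_iff₀ hr]
      have e : ‖φ r - U r / (r : ℂ) ^ 2‖ * r = ‖(r : ℂ) * φ r - u r‖ := by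
        have hr' : (r : ℂ) ≠ 0 := by exact_mod_cast hr.ne'
        rw [show (r : ℂ) * φ r - u r = (φ r - U r / (r : ℂ) ^ 2) * r by
          simp only [hu]
          field_simp, norm_mul, Complex.norm_real, Real.norm_of_nonneg hr.le]
      rw [e]
      refine (norm_sub_le _ _).trans ?_
      have h2 := hC2 r
      have h1 : ‖u r‖ ≤ C1 / ε := by
        rcases lt_or_ge r ε with hr | hr
        · rw [hu0 r hr, norm_zero]
          positivity
        · have hr0 := hε.trans_le hr
          simp only [hu, norm_div, Complex.norm_real, Real.norm_of_nonneg hr0.le]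
          gcongr
          exact hC1 r
      linarith
  have hdφ : ContDiff ℝ ∞ (deriv φ) := (contDiff_infty_iff_deriv.1 hφ).2
  have hdφ0 : ∀ r, r < ε → deriv φ r = 0 := by
    intro r hr
    have : φ =ᶠ[𝓝 r] fun _ => 0 := by
      filter_upwards [Iio_mem_nhds hr] with x hx using h0 x hx
    rw [this.deriv_eq, deriv_const]
  have hTu : T u = fun r => -deriv φ r + φ r / (r : ℂ) := by
    funext r
    rcases le_or_gt r 0 with hr | hr
    · have hrε := hr.trans_lt hε
      rw [T, indicator_of_notMem (by simpa using hr), h0 r hrε, hdφ0 r hrε]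
      simp
    · have hr' : (r : ℂ) ≠ 0 := by exact_mod_cast hr.ne'
      rw [T, indicator_of_mem (mem_Ioi.2 hr), dr_eq_deriv _ hr]
      have e : dr u =ᶠ[𝓝 r] fun r => φ r - U r / (r : ℂ) ^ 2 := by
        filter_upwards [Ioi_mem_nhds hr] with x hx
        rw [dr_eq_deriv _ hx, (hud x hx).deriv]
      have h1 : HasDerivAt (fun r : ℝ => (r : ℂ) ^ 2) (2 * r) r := by
        refine ((hasDerivAt_id r).ofReal_comp.pow 2).congr_deriv ?_
        simp
      have h2 := ((hφ.differentiable (by simp)) r).hasDerivAt.sub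
        ((hUd r).div h1 (pow_ne_zero 2 hr'))
      rw [e.deriv_eq, show deriv (fun r => φ r - U r / (r : ℂ) ^ 2) r = _ from h2.deriv]
      simp only [hu]
      field_simp
      ring
  have hTuH : MemH (T u) := by
    rw [hTu]
    have hquot : ContDiff ℝ ∞ fun r : ℝ => φ r / (r : ℂ) := by
      refine contDiff_iff_contDiffAt.2 fun r => ?_
      rcases lt_or_ge r ε with hr | hr
      · refine (contDiffAt_const (c := (0 : ℂ))).congr_of_eventuallyEq ?_
        filter_upwards [Iio_mem_nhds hr] with x hx
        rw [h0 x hx, zero_div]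
      · simp only [div_eq_mul_inv]
        refine hφ.contDiffAt.mul (hid.contDiffAt.inv ?_)
        exact_mod_cast (hε.trans_le hr).ne'
    refine memH_of_hasCompactSupport ((hdφ.neg.add hquot).of_le (by simp)) ?_ hε fun r hr => ?_
    · refine HasCompactSupport.add (hs.deriv.neg) ?_
      simp only [div_eq_mul_inv]
      exact hs.mul_right
    · rw [h0 r hr, hdφ0 r hr]
      simp
  refine ⟨H.mk u huH, ⟨hus.contDiffOn, hTuH, ?_⟩, fun r hr => ?_⟩
  · rw [H.fn_mk, dr_congr hdd le_rfl]
    have e : deriv u =ᶠ[𝓝 0] fun _ => 0 := by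
      filter_upwards [Iio_mem_nhds hε] with x hx
      have : u =ᶠ[𝓝 x] fun _ => 0 := by
        filter_upwards [Iio_mem_nhds hx] with y hy using hu0 y hy
      rw [this.deriv_eq, deriv_const]
    rw [dr, (e.filter_mono nhdsWithin_le_nhds).derivWithin_eq e.self_of_nhds]
    exact dr_zero 0
  · rw [H.fn_mk, dr_eq_deriv _ hr, (hud r hr).deriv]
    have hr' : (r : ℂ) ≠ 0 := by exact_mod_cast hr.ne'
    simp only [hu]
    field_simp
    ring

/-! ### Density and surjectivity -/

/-- The functions `u' + u / r` with `u ∈ 𝒲₀` are total in `L²(0, ∞)`. -/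
theorem eq_zero_of_forall_inner_factor {y : Lp ℂ 2 hl}
    (h : ∀ u ∈ W0, inner ℂ (factor u) y = 0) : y = 0 := by
  have hloc : LocallyIntegrableOn (y : ℝ → ℂ) (Ioi 0) := by
    have : IsLocallyFiniteMeasure hl := inferInstanceAs (IsLocallyFiniteMeasure (volume.restrict _))
    have h1 : LocallyIntegrable (y : ℝ → ℂ) hl := (Lp.memLp y).locallyIntegrable (by norm_num)
    exact locallyIntegrableOn_of_locallyIntegrable_restrict h1
  have key := isOpen_Ioi.ae_eq_zero_of_integral_contDiff_smul_eq_zero hloc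
    fun φ hφ hs hsub => by
      have hsc : HasCompactSupport fun r => (φ r : ℂ) :=
        hs.comp_left (g := fun x : ℝ => (x : ℂ)) Complex.ofReal_zero
      obtain ⟨ε, hε, h0⟩ : ∃ ε > 0, ∀ r < ε, φ r = 0 := by
        have h1 : (0 : ℝ) ∉ tsupport φ := fun h => lt_irrefl (0 : ℝ) (hsub h)
        obtain ⟨ε, hε, hb⟩ := Metric.eventually_nhds_iff.1 (notMem_tsupport_iff_eventuallyEq.1 h1)
        refine ⟨ε, hε, fun r hr => ?_⟩
        rcases le_or_gt r 0 with hr0 | hr0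
        · by_contra hne
          exact absurd (hsub (subset_tsupport _ hne)) (by simpa using hr0)
        · exact hb (by rwa [dist_zero_right, Real.norm_of_nonneg hr0.le])
      obtain ⟨u, hu, hur⟩ := exists_mem_W0
        (Complex.ofRealCLM.contDiff.comp hφ) hsc hε (fun r hr => by
          simp [h0 r hr])
      have h1 := h u hu
      rw [L2.inner_def] at h1
      have h2 : ∫ r, φ r • y r ∂hl = 0 := by
        rw [← h1]
        refine integral_congr_ae ?_
        filter_upwards [coeFn_factor u, ae_hl_pos] with r h3 hr
        rw [h3, hur r hr]
        simp [mul_comm]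
      rw [← h2]
      refine (setIntegral_eq_integral_of_forall_compl_eq_zero fun r hr => ?_).symm
      have : φ r = 0 := by
        by_contra hne
        exact hr (hsub (subset_tsupport _ hne))
      rw [this, zero_smul]
  refine Lp.ext ?_
  refine EventuallyEq.trans ?_ (Lp.coeFn_zero _ _ _).symm
  exact (ae_restrict_iff' measurableSet_Ioi).2 key

theorem dense_W0 : Dense (W0 : Set H) := by
  rw [Submodule.dense_iff_topologicalClosure_eq_top, Submodule.topologicalClosure_eq_top_iff,
    Submodule.eq_bot_iff]
  intro y hy
  refine factor_injective ?_
  rw [map_zero]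
  refine eq_zero_of_forall_inner_factor fun u hu => ?_
  rw [inner_factor]
  exact hy u hu

/-- The range of the isometry `factor` is closed, and it is dense since it contains the test
functions. -/
theorem factor_surjective : Function.Surjective factor := by
  have hc : IsClosed (LinearMap.range factor : Set (Lp ℂ 2 hl)) := by
    have := factorI.isometry.isClosedEmbedding.isClosed_range
    exact this
  have : CompleteSpace (LinearMap.range factor) := hc.completeSpace_coe
  rw [← LinearMap.range_eq_top, ← Submodule.orthogonal_eq_bot_iff, Submodule.eq_bot_iff]
  exact fun y hy => eq_zero_of_forall_inner_factor fun u _ => hy _ ⟨u, rfl⟩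

/-! ### An exponential kernel on `L²(0, ∞)` -/

/-- The Schur test. -/
theorem lintegral_sq_lintegral_mul_le {α : Type*} [MeasurableSpace α] {μ : Measure α} [SFinite μ]
    {K : α → α → ENNReal} (hK : Measurable (Function.uncurry K)) {M : ENNReal}
    (h1 : ∀ x, ∫⁻ y, K x y ∂μ ≤ M) (h2 : ∀ y, ∫⁻ x, K x y ∂μ ≤ M) {f : α → ENNReal}
    (hf : AEMeasurable f μ) :
    ∫⁻ x, (∫⁻ y, K x y * f y ∂μ) ^ 2 ∂μ ≤ M * (M * ∫⁻ y, f y ^ 2 ∂μ) := by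
  have hKx : ∀ x, Measurable (K x) := fun x => hK.comp measurable_prodMk_left
  have hpt : ∀ x, (∫⁻ y, K x y * f y ∂μ) ^ 2 ≤ M * ∫⁻ y, K x y * f y ^ 2 ∂μ := by
    intro x
    have h3 := ENNReal.lintegral_mul_norm_pow_le (hKx x).aemeasurable
      ((hKx x).aemeasurable.mul (hf.pow_const 2)) (p := 1 / 2) (q := 1 / 2) (by norm_num)
      (by norm_num) (by norm_num)
    have e : ∀ y, K x y ^ (1 / 2 : ℝ) * ((K x * fun y => f y ^ 2) y) ^ (1 / 2 : ℝ)
        = K x y * f y := by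
      intro y
      rw [Pi.mul_apply, ENNReal.mul_rpow_of_nonneg _ _ (by norm_num), ← mul_assoc,
        ← ENNReal.rpow_add_of_nonneg _ _ (by norm_num) (by norm_num),
        ← ENNReal.rpow_natCast_mul]
      norm_num
    simp only [e] at h3
    calc (∫⁻ y, K x y * f y ∂μ) ^ 2
        ≤ ((∫⁻ y, K x y ∂μ) ^ (1 / 2 : ℝ) * (∫⁻ y, K x y * f y ^ 2 ∂μ) ^ (1 / 2 : ℝ)) ^ 2 := by
          gcongr
          exact h3
      _ = (∫⁻ y, K x y ∂μ) * ∫⁻ y, K x y * f y ^ 2 ∂μ := by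
          rw [mul_pow, ← ENNReal.rpow_mul_natCast, ← ENNReal.rpow_mul_natCast]
          norm_num
      _ ≤ M * ∫⁻ y, K x y * f y ^ 2 ∂μ := by
          gcongr
          exact h1 x
  have hmeas : AEMeasurable (Function.uncurry fun x y => K x y * f y ^ 2) (μ.prod μ) :=
    hK.aemeasurable.mul
      ((hf.comp_quasiMeasurePreserving Measure.quasiMeasurePreserving_snd).pow_const 2)
  calc ∫⁻ x, (∫⁻ y, K x y * f y ∂μ) ^ 2 ∂μ
      ≤ ∫⁻ x, M * ∫⁻ y, K x y * f y ^ 2 ∂μ ∂μ := lintegral_mono hpt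
    _ = M * ∫⁻ x, ∫⁻ y, K x y * f y ^ 2 ∂μ ∂μ :=
        lintegral_const_mul'' _ hmeas.lintegral_prod_right'
    _ = M * ∫⁻ y, ∫⁻ x, K x y * f y ^ 2 ∂μ ∂μ := by rw [lintegral_lintegral_swap hmeas]
    _ = M * ∫⁻ y, (∫⁻ x, K x y ∂μ) * f y ^ 2 ∂μ := by
        congr 1
        refine lintegral_congr fun y => ?_
        exact lintegral_mul_const _ (hK.comp measurable_prodMk_right)
    _ ≤ M * ∫⁻ y, M * f y ^ 2 ∂μ := by
        gcongr with y
        exact h2 y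
    _ = M * (M * ∫⁻ y, f y ^ 2 ∂μ) := by rw [lintegral_const_mul'' _ (hf.pow_const 2)]

/-- The kernel `exp(-m |s|)`. -/
def expKernel (m s : ℝ) : ENNReal := ENNReal.ofReal (Real.exp (-m * |s|))

theorem measurable_expKernel (m : ℝ) : Measurable (expKernel m) := by
  unfold expKernel
  fun_prop

theorem lintegral_expKernel_lt_top {m : ℝ} (hm : 0 < m) : ∫⁻ s, expKernel m s < ⊤ := by
  have h1 : IntegrableOn (fun s : ℝ => Real.exp (-m * |s|)) (Ioi 0) :=
    (exp_neg_integrableOn_Ioi 0 hm).congr_fun (fun s hs => by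
      dsimp only
      rw [abs_of_pos (mem_Ioi.1 hs)]) measurableSet_Ioi
  have h2 : IntegrableOn (fun s : ℝ => Real.exp (-m * |s|)) (Iic 0) :=
    (integrableOn_exp_mul_Iic hm 0).congr_fun (fun s hs => by
      dsimp only
      rw [abs_of_nonpos (mem_Iic.1 hs), neg_mul_neg]) measurableSet_Iic
  have h3 : Integrable (fun s : ℝ => Real.exp (-m * |s|)) := by
    rw [← integrableOn_univ, ← Iic_union_Ioi (a := (0 : ℝ))]
    exact h2.union h1
  exact h3.lintegral_lt_top

/-- A function dominated by the convolution of `exp(-m |·|)` with a function in `L²(0, ∞)` lies in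
`L²(0, ∞)`. -/
theorem memLp_two_of_enorm_le {m : ℝ} (hm : 0 < m) {f p : ℝ → ℂ} (hf : MemLp f 2 hl)
    (hp : AEStronglyMeasurable p hl)
    (h : ∀ r, 0 < r → ‖p r‖ₑ ≤ ∫⁻ t, expKernel m (r - t) * ‖f t‖ₑ ∂hl) : MemLp p 2 hl := by
  have : SFinite hl := inferInstanceAs (SFinite (volume.restrict _))
  refine ⟨hp, ?_⟩
  have hf2 := (eLpNorm_lt_top_iff_lintegral_rpow_enorm_lt_top two_ne_zero
    ENNReal.ofNat_ne_top).1 hf.2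
  rw [eLpNorm_lt_top_iff_lintegral_rpow_enorm_lt_top two_ne_zero ENNReal.ofNat_ne_top]
  simp only [ENNReal.toReal_ofNat, ENNReal.rpow_ofNat] at hf2 ⊢
  set M := ∫⁻ s, expKernel m s with hM
  have hK : Measurable (Function.uncurry fun r t : ℝ => expKernel m (r - t)) :=
    (measurable_expKernel m).comp (measurable_fst.sub measurable_snd)
  have hle : ∀ g : ℝ → ENNReal, ∫⁻ t, g t ∂hl ≤ ∫⁻ t, g t := fun g =>
    lintegral_mono' Measure.restrict_le_self le_rfl
  have key := lintegral_sq_lintegral_mul_le (μ := hl) (M := M) hK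
    (fun r => (hle _).trans (lintegral_sub_left_eq_self (expKernel m) r).le)
    (fun t => (hle _).trans (lintegral_sub_right_eq_self (expKernel m) t).le)
    hf.1.enorm
  have hM' := lintegral_expKernel_lt_top hm
  refine lt_of_le_of_lt ((lintegral_mono_ae ?_).trans key)
    (ENNReal.mul_lt_top hM' (ENNReal.mul_lt_top hM' hf2))
  filter_upwards [ae_hl_pos] with r hr
  gcongr
  exact h r hr

theorem memLp_exp {m : ℝ} (hm : 0 < m) : MemLp (fun r : ℝ => Complex.exp (-m * r)) 2 hl := by
  rw [memLp_two_iff_integrable_sq_norm (by fun_prop)]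
  have h := exp_neg_integrableOn_Ioi 0 (show 0 < 2 * m by positivity)
  refine Integrable.congr h (Eventually.of_forall fun r => ?_)
  dsimp only
  rw [← Complex.ofReal_neg, ← Complex.ofReal_mul, Complex.norm_exp, Complex.ofReal_re,
    ← Real.exp_nat_mul]
  congr 1
  push_cast
  ring

/-! ### The resolvent of `-d²/dr²` with a Robin condition -/

theorem enorm_exp_mul (m s : ℝ) (hs : m * s = -m * |s|) (z : ℂ) :
    ‖Complex.exp (m * s) * z‖ₑ = expKernel m s * ‖z‖ₑ := by
  rw [enorm_mul, expKernel, ← hs, ← ofReal_norm (Complex.exp _), ← Complex.ofReal_mul,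
    Complex.norm_exp, Complex.ofReal_re]

/-- Solution of `-p' + m p = F` in `L²(0, ∞)`. -/
theorem exists_backward_solution {m : ℝ} (hm : 0 < m) {F : ℝ → ℂ} (hF : MemLp F 2 hl) :
    ∃ p : ℝ → ℂ, Continuous p ∧ MemLp p 2 hl ∧ IsPrim p fun r => m * p r - F r := by
  set G : ℝ → ℂ := (Ioi 0).indicator fun t : ℝ => Complex.exp (-m * t) * F t with hG
  have hG0 : IntegrableOn (fun t : ℝ => Complex.exp (-m * t) * F t) (Ioi 0) :=
    (memLp_exp hm).integrable_mul hF
  have hGi : Integrable G := hG0.integrable_indicator measurableSet_Ioi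
  have hI : ∀ r, ∫ t in Ioi r, G t = (∫ t in Ioi 0, G t) - ∫ t in 0..r, G t := by
    intro r
    rw [← intervalIntegral.integral_interval_add_Ioi (a := 0) (b := r) hGi.integrableOn
      hGi.integrableOn]
    ring
  have hIc : Continuous fun r => ∫ t in Ioi r, G t := by
    rw [funext hI]
    exact continuous_const.sub
      (intervalIntegral.continuous_primitive (fun _ _ => hGi.intervalIntegrable) 0)
  have hIp : IsPrim (fun r => ∫ t in Ioi r, G t) (fun r => 0 - G r) := by
    rw [funext hI]
    exact (IsPrim.const _).sub (IsPrim.of_integral fun _ _ => hGi.intervalIntegrable)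
  have hexp : IsPrim (fun r : ℝ => Complex.exp (m * r)) fun r => m * Complex.exp (m * r) := by
    refine IsPrim.of_hasDerivAt (fun r _ => ?_) (by fun_prop)
    refine (((hasDerivAt_id r).ofReal_comp.const_mul (m : ℂ)).cexp).congr_deriv ?_
    simp [mul_comm]
  have hpc : Continuous fun r : ℝ => Complex.exp (m * r) * ∫ t in Ioi r, G t := by fun_prop
  refine ⟨fun r => Complex.exp (m * r) * ∫ t in Ioi r, G t, hpc, ?_, ?_⟩
  · refine memLp_two_of_enorm_le hm hF hpc.aestronglyMeasurable fun r hr => ?_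
    rw [← integral_const_mul]
    refine (enorm_integral_le_lintegral_enorm _).trans ?_
    calc ∫⁻ t in Ioi r, ‖Complex.exp (m * r) * G t‖ₑ
        = ∫⁻ t in Ioi r, expKernel m (r - t) * ‖F t‖ₑ := by
          refine setLIntegral_congr_fun measurableSet_Ioi fun t ht => ?_
          have ht' : r < t := ht
          rw [hG, indicator_of_mem (mem_Ioi.2 (hr.trans ht')), ← mul_assoc, ← Complex.exp_add,
            ← enorm_exp_mul m (r - t) (by rw [abs_of_neg (by linarith)]; ring)]
          congr 3
          push_cast
          ring
      _ ≤ ∫⁻ t, expKernel m (r - t) * ‖F t‖ₑ ∂hl :=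
          lintegral_mono' (Measure.restrict_mono (Ioi_subset_Ioi hr.le) le_rfl) le_rfl
  · refine (hexp.mul hIp).congr (fun _ _ => rfl) ?_
    filter_upwards [ae_hl_pos] with r hr
    have e : Complex.exp (m * r) * Complex.exp (-m * r) = 1 := by
      rw [← Complex.exp_add]
      simp
    rw [hG, indicator_of_mem (mem_Ioi.2 hr)]
    linear_combination (-F r) * e

/-- Solution of `h' + m h = p` in `L²(0, ∞)`, with a prescribed value at `0`. -/
theorem exists_forward_solution {m : ℝ} (hm : 0 < m) {p : ℝ → ℂ} (hpc : Continuous p)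
    (hp : MemLp p 2 hl) (c : ℂ) :
    ∃ h : ℝ → ℂ, (∀ r, HasDerivAt h (p r - m * h r) r) ∧ MemLp h 2 hl ∧ h 0 = c := by
  have hqc : Continuous fun t : ℝ => Complex.exp (m * t) * p t := by fun_prop
  set q : ℝ → ℂ := fun r => ∫ t in 0..r, Complex.exp (m * t) * p t with hq
  have hqd : ∀ r : ℝ, HasDerivAt q (Complex.exp (m * r) * p r) r := fun r =>
    intervalIntegral.integral_hasDerivAt_right (hqc.intervalIntegrable _ _)
      (hqc.stronglyMeasurableAtFilter _ _) hqc.continuousAt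
  have hqcont : Continuous q := continuous_iff_continuousAt.2 fun r => (hqd r).continuousAt
  refine ⟨fun r => c * Complex.exp (-m * r) + Complex.exp (-m * r) * q r, fun r => ?_, ?_, ?_⟩
  · have he : HasDerivAt (fun r : ℝ => Complex.exp (-m * r)) (-m * Complex.exp (-m * r)) r := by
      refine (((hasDerivAt_id r).ofReal_comp.const_mul (-m : ℂ)).cexp).congr_deriv ?_
      simp [mul_comm]
    refine ((he.const_mul c).add (he.mul (hqd r))).congr_deriv ?_
    have e : Complex.exp (-m * r) * Complex.exp (m * r) = 1 := by
      rw [← Complex.exp_add]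
      simp
    linear_combination (p r) * e
  · refine ((memLp_exp hm).const_mul c).add ?_
    refine memLp_two_of_enorm_le hm hp (by fun_prop) fun r hr => ?_
    simp only [hq]
    rw [intervalIntegral.integral_of_le hr.le, ← integral_const_mul]
    refine (enorm_integral_le_lintegral_enorm _).trans ?_
    calc ∫⁻ t in Ioc 0 r, ‖Complex.exp (-m * r) * (Complex.exp (m * t) * p t)‖ₑ
        = ∫⁻ t in Ioc 0 r, expKernel m (r - t) * ‖p t‖ₑ := by
          refine setLIntegral_congr_fun measurableSet_Ioc fun t ht => ?_
          have ht' : t ≤ r := ht.2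
          have e : expKernel m (r - t) = expKernel m (t - r) := by
            rw [expKernel, expKernel, abs_sub_comm]
          rw [e, ← mul_assoc, ← Complex.exp_add,
            ← enorm_exp_mul m (t - r) (by rw [abs_of_nonpos (by linarith)]; ring)]
          congr 3
          push_cast
          ring
      _ ≤ ∫⁻ t, expKernel m (r - t) * ‖p t‖ₑ ∂hl :=
          lintegral_mono' (Measure.restrict_mono Ioc_subset_Ioi_self le_rfl) le_rfl
  · simp [hq]

/-! ### Regularity of preimages of differentiable functions -/

theorem isLittleO_integral_mul {k : ℝ → ℂ} (hk : k =o[𝓝 0] fun t : ℝ => t) :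
    (fun r => ∫ t in 0..r, (t : ℂ) * k t) =o[𝓝[>] 0] fun r : ℝ => r ^ 3 := by
  rw [Asymptotics.isLittleO_iff]
  intro c hc
  obtain ⟨δ, hδ, hb⟩ := Metric.eventually_nhds_iff.1 ((Asymptotics.isLittleO_iff.1 hk) hc)
  filter_upwards [Ioo_mem_nhdsGT hδ] with r hr
  have h1 : ∀ t ∈ uIoc 0 r, ‖(t : ℂ) * k t‖ ≤ c * r ^ 2 := by
    intro t ht
    rw [uIoc_of_le hr.1.le] at ht
    have h2 := hb (y := t) (by
      rw [dist_zero_right, Real.norm_of_nonneg ht.1.le]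
      exact ht.2.trans_lt hr.2)
    rw [Real.norm_of_nonneg ht.1.le] at h2
    rw [norm_mul, Complex.norm_real, Real.norm_of_nonneg ht.1.le]
    calc t * ‖k t‖ ≤ r * (c * r) := by
          gcongr
          · exact hr.1.le
          · exact ht.2
          · exact h2.trans (by gcongr; exact ht.2)
      _ = c * r ^ 2 := by ring
  have h3 := intervalIntegral.norm_integral_le_of_norm_le_const h1
  rw [sub_zero, abs_of_pos hr.1] at h3
  rw [Real.norm_of_nonneg (by have := hr.1; positivity)]
  linarith

section Regularity

variable {h h' : ℝ → ℂ} {u : H}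

theorem continuous_of_hasDerivAt (hd : ∀ r, HasDerivAt h (h' r) r) : Continuous h :=
  continuous_iff_continuousAt.2 fun r => (hd r).continuousAt

theorem isPrim_mul_fn (u : H) {g : ℝ → ℂ} (hu : factor u =ᵐ[hl] g) :
    IsPrim (fun r => (r : ℂ) * u.fn r) (fun r => (r : ℂ) * g r) := by
  refine (IsPrim.ofReal.mul (IsPrim.of_memH u.memH)).congr (fun _ _ => rfl) ?_
  filter_upwards [coeFn_factor u, hu, ae_hl_pos] with r h1 h2 hr
  have hr' : (r : ℂ) ≠ 0 := by exact_mod_cast hr.ne'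
  rw [← h2, h1]
  field_simp
  ring

theorem MemH.tendsto_zero {w : ℝ → ℂ} (hw : MemH w) : Tendsto w (𝓝[>] 0) (𝓝 0) := by
  have h := (hw.ac 1 one_pos).continuousOn 0 (by simp)
  rw [uIcc_of_le zero_le_one, ContinuousWithinAt, hw.zero_of_nonpos 0 le_rfl] at h
  have h1 := h.mono_left (nhdsWithin_mono 0 (Ioc_subset_Icc_self (a := (0 : ℝ)) (b := 1)))
  rwa [nhdsWithin_Ioc_eq_nhdsGT one_pos] at h1

theorem tendsto_ofReal_zero : Tendsto (fun r : ℝ => (r : ℂ)) (𝓝[>] 0) (𝓝 0) := by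
  have : Tendsto (fun r : ℝ => (r : ℂ)) (𝓝 0) (𝓝 ((0 : ℝ) : ℂ)) :=
    Complex.continuous_ofReal.tendsto 0
  rw [Complex.ofReal_zero] at this
  exact this.mono_left nhdsWithin_le_nhds

theorem mul_fn_tendsto_zero (u : H) : Tendsto (fun r : ℝ => (r : ℂ) * u.fn r) (𝓝[>] 0) (𝓝 0) := by
  simpa using tendsto_ofReal_zero.mul u.memH.tendsto_zero

/-- If `u' + u / r = h` almost everywhere, then `r u(r) = ∫₀^r t h(t) dt`. -/
theorem mul_fn_eq_integral (hh : Continuous h) (hu : factor u =ᵐ[hl] h) {r : ℝ} (hr : 0 < r) :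
    (r : ℂ) * u.fn r = ∫ t in 0..r, (t : ℂ) * h t := by
  have hc : Continuous fun t : ℝ => (t : ℂ) * h t := by fun_prop
  have h1 := IsPrim.of_integral fun b _ => hc.intervalIntegrable (μ := volume) 0 b
  refine (isPrim_mul_fn u hu).eqOn_of_tendsto h1 (mul_fn_tendsto_zero u) ?_ hr
  have h2 := (intervalIntegral.continuous_primitive (μ := volume)
    (fun a b => hc.intervalIntegrable a b) 0).tendsto 0
  rw [intervalIntegral.integral_same] at h2
  exact h2.mono_left nhdsWithin_le_nhds

theorem hasDerivAt_fn (hh : Continuous h) (hu : factor u =ᵐ[hl] h) {r : ℝ} (hr : 0 < r) :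
    HasDerivAt u.fn (h r - u.fn r / (r : ℂ)) r := by
  have hc : Continuous fun t : ℝ => (t : ℂ) * h t := by fun_prop
  have hr' : (r : ℂ) ≠ 0 := by exact_mod_cast hr.ne'
  have h1 : HasDerivAt (fun r => ∫ t in 0..r, (t : ℂ) * h t) ((r : ℂ) * h r) r :=
    intervalIntegral.integral_hasDerivAt_right (hc.intervalIntegrable _ _)
      (hc.stronglyMeasurableAtFilter _ _) hc.continuousAt
  have h2 := h1.div (hasDerivAt_id r).ofReal_comp hr'
  have h3 : HasDerivAt u.fn _ r := h2.congr_of_eventuallyEq <| by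
    filter_upwards [Ioi_mem_nhds hr] with x hx
    have hx' : (x : ℂ) ≠ 0 := by exact_mod_cast (ne_of_gt (mem_Ioi.1 hx))
    rw [Pi.div_apply, ← mul_fn_eq_integral hh hu hx]
    simp only [id]
    field_simp
  refine h3.congr_deriv ?_
  rw [← mul_fn_eq_integral hh hu hr]
  simp only [id, Complex.ofReal_one]
  field_simp

/-- The Taylor remainder of `∫₀^r t h(t) dt` is of order `o(r³)`. -/
theorem mul_fn_taylor (hd : ∀ r, HasDerivAt h (h' r) r) (hu : factor u =ᵐ[hl] h) :
    (fun r : ℝ => (r : ℂ) * u.fn r - ((r : ℂ) ^ 2 * (h 0 / 2) + (r : ℂ) ^ 3 * (h' 0 / 3)))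
      =o[𝓝[>] 0] fun r : ℝ => r ^ 3 := by
  have hh := continuous_of_hasDerivAt hd
  have hk : (fun t : ℝ => h t - h 0 - (t : ℂ) * h' 0) =o[𝓝 0] fun t : ℝ => t := by
    have := hasDerivAt_iff_isLittleO.1 (hd 0)
    simpa using this
  refine (isLittleO_integral_mul hk).congr' ?_ EventuallyEq.rfl
  filter_upwards [self_mem_nhdsWithin] with r hr
  rw [mul_fn_eq_integral hh hu hr, eq_sub_iff_add_eq, ← eq_sub_iff_add_eq']
  have hd3 : ∀ t : ℝ, HasDerivAt (fun t : ℝ => (t : ℂ) ^ 2 * (h 0 / 2) + (t : ℂ) ^ 3 * (h' 0 / 3))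
      ((t : ℂ) * (h 0 + t * h' 0)) t := by
    intro t
    have e := (hasDerivAt_id t).ofReal_comp
    refine (((e.pow 2).mul_const (h 0 / 2)).add ((e.pow 3).mul_const (h' 0 / 3))).congr_deriv ?_
    simp only [id, Complex.ofReal_one]
    push_cast
    ring
  have h4 := intervalIntegral.integral_eq_sub_of_hasDerivAt (a := 0) (b := r)
    (fun t _ => hd3 t) ((by fun_prop : Continuous _).intervalIntegrable _ _)
  simp only [Complex.ofReal_zero, ne_eq, OfNat.ofNat_ne_zero, not_false_eq_true, zero_pow,
    zero_mul, add_zero, sub_zero] at h4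
  rw [← h4, ← intervalIntegral.integral_sub ((by fun_prop : Continuous _).intervalIntegrable _ _)
    ((by fun_prop : Continuous _).intervalIntegrable _ _)]
  refine intervalIntegral.integral_congr fun t _ => ?_
  ring

theorem tendsto_fn_taylor (hd : ∀ r, HasDerivAt h (h' r) r) (hu : factor u =ᵐ[hl] h) :
    Tendsto (fun r : ℝ => (u.fn r - (r : ℂ) * (h 0 / 2)) / (r : ℂ) ^ 2) (𝓝[>] 0)
      (𝓝 (h' 0 / 3)) := by
  have h1 : (fun r : ℝ => (r : ℂ) * u.fn r
      - ((r : ℂ) ^ 2 * (h 0 / 2) + (r : ℂ) ^ 3 * (h' 0 / 3))) =o[𝓝[>] 0]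
      fun r : ℝ => (r : ℂ) ^ 3 := by
    refine (mul_fn_taylor hd hu).trans_isBigO (Asymptotics.isBigO_of_le _ fun r => ?_)
    simp
  have h2 := h1.tendsto_div_nhds_zero.add_const (h' 0 / 3)
  rw [zero_add] at h2
  refine h2.congr' ?_
  filter_upwards [self_mem_nhdsWithin] with r hr
  have hr' : (r : ℂ) ≠ 0 := by exact_mod_cast (ne_of_gt (mem_Ioi.1 hr))
  field_simp
  ring

theorem hasDerivWithinAt_fn_zero (hd : ∀ r, HasDerivAt h (h' r) r) (hu : factor u =ᵐ[hl] h) :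
    HasDerivWithinAt u.fn (h 0 / 2) (Ici 0) 0 := by
  rw [← hasDerivWithinAt_Ioi_iff_Ici, hasDerivWithinAt_iff_tendsto_slope' (by simp)]
  have h1 := (tendsto_ofReal_zero.mul (tendsto_fn_taylor hd hu)).add_const (h 0 / 2)
  rw [zero_mul, zero_add] at h1
  refine h1.congr' ?_
  filter_upwards [self_mem_nhdsWithin] with r hr
  have hr' : (r : ℂ) ≠ 0 := by exact_mod_cast (ne_of_gt (mem_Ioi.1 hr))
  rw [slope_def_module, u.memH.zero_of_nonpos 0 le_rfl, Complex.real_smul]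
  push_cast
  field_simp
  ring

theorem hasDerivWithinAt_dr_zero (hd : ∀ r, HasDerivAt h (h' r) r) (hu : factor u =ᵐ[hl] h) :
    HasDerivWithinAt (dr u.fn) (2 * h' 0 / 3) (Ici 0) 0 := by
  have hh := continuous_of_hasDerivAt hd
  have h0 : dr u.fn 0 = h 0 / 2 :=
    (hasDerivWithinAt_fn_zero hd hu).derivWithin (uniqueDiffOn_Ici 0 0 (mem_Ici.2 le_rfl))
  have hs : Tendsto (slope h 0) (𝓝[>] 0) (𝓝 (h' 0)) :=
    (hasDerivWithinAt_iff_tendsto_slope' (by simp)).1 (hd 0).hasDerivWithinAt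
  rw [← hasDerivWithinAt_Ioi_iff_Ici, hasDerivWithinAt_iff_tendsto_slope' (by simp)]
  have h1 := hs.sub (tendsto_fn_taylor hd hu)
  rw [show h' 0 - h' 0 / 3 = 2 * h' 0 / 3 by ring] at h1
  refine h1.congr' ?_
  filter_upwards [self_mem_nhdsWithin] with r hr
  have hr' : (r : ℂ) ≠ 0 := by exact_mod_cast (ne_of_gt (mem_Ioi.1 hr))
  rw [slope_def_module, slope_def_module, h0, dr_eq_deriv _ hr, (hasDerivAt_fn hh hu hr).deriv,
    Complex.real_smul, Complex.real_smul]
  push_cast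
  field_simp
  ring

theorem hasDerivAt_dr (hd : ∀ r, HasDerivAt h (h' r) r) (hu : factor u =ᵐ[hl] h) {r : ℝ}
    (hr : 0 < r) :
    HasDerivAt (dr u.fn) (h' r - h r / (r : ℂ) + 2 * u.fn r / (r : ℂ) ^ 2) r := by
  have hh := continuous_of_hasDerivAt hd
  have hr' : (r : ℂ) ≠ 0 := by exact_mod_cast hr.ne'
  have h1 := (hd r).sub ((hasDerivAt_fn hh hu hr).div (hasDerivAt_id r).ofReal_comp hr')
  have h2 : HasDerivAt (dr u.fn) _ r := h1.congr_of_eventuallyEq <| by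
    filter_upwards [Ioi_mem_nhds hr] with x hx
    rw [dr_eq_deriv _ hx, (hasDerivAt_fn hh hu hx).deriv]
    rfl
  refine h2.congr_deriv ?_
  simp only [id, Complex.ofReal_one]
  field_simp
  ring

theorem twiceDiff_fn (hd : ∀ r, HasDerivAt h (h' r) r) (hu : factor u =ᵐ[hl] h) :
    TwiceDiff u.fn := by
  have hh := continuous_of_hasDerivAt hd
  constructor
  · intro r hr
    rcases (mem_Ici.1 hr).eq_or_lt with rfl | hr
    · exact (hasDerivWithinAt_fn_zero hd hu).differentiableWithinAt
    · exact (hasDerivAt_fn hh hu hr).differentiableAt.differentiableWithinAt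
  · intro r hr
    rcases (mem_Ici.1 hr).eq_or_lt with rfl | hr
    · exact (hasDerivWithinAt_dr_zero hd hu).differentiableWithinAt
    · exact (hasDerivAt_dr hd hu hr).differentiableAt.differentiableWithinAt

theorem dr_fn_zero (hd : ∀ r, HasDerivAt h (h' r) r) (hu : factor u =ᵐ[hl] h) :
    dr u.fn 0 = h 0 / 2 :=
  (hasDerivWithinAt_fn_zero hd hu).derivWithin (uniqueDiffOn_Ici 0 0 (mem_Ici.2 le_rfl))

theorem dr_dr_fn_zero (hd : ∀ r, HasDerivAt h (h' r) r) (hu : factor u =ᵐ[hl] h) :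
    dr (dr u.fn) 0 = 2 * h' 0 / 3 :=
  (hasDerivWithinAt_dr_zero hd hu).derivWithin (uniqueDiffOn_Ici 0 0 (mem_Ici.2 le_rfl))

theorem Tadd_fn (hd : ∀ r, HasDerivAt h (h' r) r) (hu : factor u =ᵐ[hl] h) {r : ℝ} (hr : 0 < r) :
    Tadd u.fn r = -h' r + (h r - h 0) / (r : ℂ) := by
  have hr' : (r : ℂ) ≠ 0 := by exact_mod_cast hr.ne'
  rw [Tadd, indicator_of_mem (mem_Ioi.2 hr), T, indicator_of_mem (mem_Ioi.2 hr),
    dr_fn_zero hd hu, dr_eq_deriv (dr u.fn) hr, (hasDerivAt_dr hd hu hr).deriv]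
  field_simp
  ring

end Regularity

/-- `T_κ + m²` is onto for `m > |κ|`. -/
theorem exists_mem_W_Tadd_add {κ m : ℝ} (hm : |κ| < m) (f : H) :
    ∃ u ∈ W κ, Tadd u.fn + (m ^ 2 : ℂ) • u.fn = f.fn := by
  have hm0 : 0 < m := (abs_nonneg κ).trans_lt hm
  have hmk : (m + κ : ℂ) ≠ 0 := by
    have : 0 < m + κ := by linarith [neg_abs_le κ]
    exact_mod_cast this.ne'
  obtain ⟨p, hpc, hp2, hpp⟩ := exists_backward_solution hm0 (Lp.memLp (factor f))
  -- the value at `0` is chosen so that `h'(0) = p(0) - m h(0)` equals `κ h(0)`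
  obtain ⟨h, hd, hh2, hh0⟩ := exists_forward_solution hm0 hpc hp2 (p 0 / (m + κ))
  obtain ⟨u, hu⟩ := factor_surjective (hh2.toLp h)
  have hu : factor u =ᵐ[hl] h := by
    rw [hu]
    exact hh2.coeFn_toLp
  have hh := continuous_of_hasDerivAt hd
  have hTd := twiceDiff_fn hd hu
  have hT : Tadd u.fn + (m ^ 2 : ℂ) • u.fn = f.fn := by
    funext r
    rcases le_or_gt r 0 with hr | hr
    · simp [Tadd, indicator_of_notMem (by simpa using hr : r ∉ Ioi 0),
        u.memH.zero_of_nonpos r hr, f.memH.zero_of_nonpos r hr]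
    have hr' : (r : ℂ) ≠ 0 := by exact_mod_cast hr.ne'
    have hhp : IsPrim h fun r => p r - m * h r :=
      IsPrim.of_hasDerivAt (fun r _ => hd r) (by fun_prop)
    have hL := (isPrim_mul_fn f EventuallyEq.rfl).sub
      ((IsPrim.const (m ^ 2 : ℂ)).mul (isPrim_mul_fn u hu))
    have hR := (((IsPrim.const (m : ℂ)).mul (IsPrim.ofReal.mul hhp)).sub
      (IsPrim.ofReal.mul hpp)).add (hhp.sub (IsPrim.const (h 0)))
    have hR' := hR.congr (fun _ _ => rfl) (g' := fun r : ℝ => (r : ℂ) * factor f r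
      - (0 * ((r : ℂ) * u.fn r) + (m ^ 2 : ℂ) * ((r : ℂ) * h r)))
      (Eventually.of_forall fun r => by dsimp only; ring)
    have hL0 : Tendsto (fun r : ℝ => (r : ℂ) * f.fn r - (m ^ 2 : ℂ) * ((r : ℂ) * u.fn r))
        (𝓝[>] 0) (𝓝 0) := by
      simpa using (mul_fn_tendsto_zero f).sub ((mul_fn_tendsto_zero u).const_mul (m ^ 2 : ℂ))
    have hR0 : Tendsto (fun r : ℝ => (m : ℂ) * ((r : ℂ) * h r) - (r : ℂ) * p r + (h r - h 0))
        (𝓝[>] 0) (𝓝 0) := by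
      have : Continuous fun r : ℝ => (m : ℂ) * ((r : ℂ) * h r) - (r : ℂ) * p r + (h r - h 0) := by
        fun_prop
      have h1 := (this.tendsto 0).mono_left (nhdsWithin_le_nhds (s := Ioi 0))
      simpa using h1
    -- `r (f - m² u) = m r h - r p + h - h(0)`: the derivatives agree almost everywhere, and both
    -- sides vanish at the origin
    have key := hL.eqOn_of_tendsto hR' hL0 hR0 hr
    dsimp only at key
    rw [Pi.add_apply, Pi.smul_apply, Tadd_fn hd hu hr, smul_eq_mul]
    field_simp
    linear_combination -key
  refine ⟨u, ⟨hTd, ?_, ?_⟩, hT⟩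
  · rw [eq_sub_of_add_eq hT]
    exact (f - (m ^ 2 : ℂ) • u).memH
  · rw [dr_dr_fn_zero hd hu, dr_fn_zero hd hu, hh0]
    field_simp
    ring

/-! ### Behaviour at the origin -/

section Origin

variable {u : ℝ → ℂ}

theorem TwiceDiff.hasDerivAt (hu : TwiceDiff u) {r : ℝ} (hr : 0 < r) : HasDerivAt u (dr u r) r := by
  rw [dr_eq_deriv u hr]
  exact ((hu.1 r hr.le).differentiableAt (Ici_mem_nhds hr)).hasDerivAt

theorem TwiceDiff.hasDerivAt_dr (hu : TwiceDiff u) {r : ℝ} (hr : 0 < r) :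
    HasDerivAt (dr u) (dr (dr u) r) r := by
  rw [dr_eq_deriv (dr u) hr]
  exact ((hu.2 r hr.le).differentiableAt (Ici_mem_nhds hr)).hasDerivAt

theorem TwiceDiff.tendsto_dr (hu : TwiceDiff u) : Tendsto (dr u) (𝓝[>] 0) (𝓝 (dr u 0)) :=
  ((hu.2 0 (mem_Ici.2 le_rfl)).continuousWithinAt).mono_left (nhdsWithin_mono 0 Ioi_subset_Ici_self)

theorem TwiceDiff.tendsto_div (hu : TwiceDiff u) (h0 : u 0 = 0) :
    Tendsto (fun r : ℝ => u r / (r : ℂ)) (𝓝[>] 0) (𝓝 (dr u 0)) := by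
  have h1 := (hu.1 0 (mem_Ici.2 le_rfl)).hasDerivWithinAt
  rw [← hasDerivWithinAt_Ioi_iff_Ici, hasDerivWithinAt_iff_tendsto_slope' (by simp)] at h1
  refine h1.congr fun r => ?_
  rw [slope_def_module, h0, Complex.real_smul]
  push_cast
  rw [sub_zero, sub_zero, inv_mul_eq_div]

theorem TwiceDiff.tendsto_dr_sub_div (hu : TwiceDiff u) :
    Tendsto (fun r : ℝ => (dr u r - dr u 0) / (r : ℂ)) (𝓝[>] 0) (𝓝 (dr (dr u) 0)) := by
  have h1 := (hu.2 0 (mem_Ici.2 le_rfl)).hasDerivWithinAt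
  rw [← hasDerivWithinAt_Ioi_iff_Ici, hasDerivWithinAt_iff_tendsto_slope' (by simp)] at h1
  refine h1.congr fun r => ?_
  rw [slope_def_module, Complex.real_smul]
  push_cast
  rw [sub_zero, inv_mul_eq_div]

/-- The second-order Taylor expansion at `0`, for a function that is twice differentiable with no
continuity of the second derivative. -/
theorem TwiceDiff.tendsto_sub_div_sq (hu : TwiceDiff u) (h0 : u 0 = 0) :
    Tendsto (fun r : ℝ => (u r - dr u 0 * r) / (r : ℂ) ^ 2) (𝓝[>] 0)
      (𝓝 (dr (dr u) 0 / 2)) := by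
  rw [Metric.tendsto_nhdsWithin_nhds]
  intro ε hε
  obtain ⟨δ, hδ, hb⟩ := (Metric.tendsto_nhdsWithin_nhds.1 hu.tendsto_dr_sub_div) (ε / 2)
    (half_pos hε)
  refine ⟨δ, hδ, fun {r} hr hrδ => ?_⟩
  rw [mem_Ioi] at hr
  rw [dist_zero_right, Real.norm_of_nonneg hr.le] at hrδ
  have hd : ∀ x ∈ Icc 0 r, HasDerivWithinAt
      (fun x : ℝ => u x - dr u 0 * x - dr (dr u) 0 / 2 * (x : ℂ) ^ 2)
      (dr u x - dr u 0 - dr (dr u) 0 * x) (Icc 0 r) x := by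
    intro x hx
    have h1 : HasDerivWithinAt u (dr u x) (Icc 0 r) x :=
      ((hu.1 x hx.1).hasDerivWithinAt).mono Icc_subset_Ici_self
    have e := (hasDerivAt_id x).ofReal_comp
    have h2 := ((e.const_mul (dr u 0)).hasDerivWithinAt (s := Icc 0 r))
    have h3 := (((e.pow 2).const_mul (dr (dr u) 0 / 2)).hasDerivWithinAt (s := Icc 0 r))
    refine ((h1.sub h2).sub h3).congr_deriv ?_
    simp only [id, Complex.ofReal_one]
    push_cast
    ring
  have hbd : ∀ x ∈ Icc 0 r, ‖dr u x - dr u 0 - dr (dr u) 0 * x‖ ≤ ε / 2 * r := by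
    intro x hx
    rcases hx.1.eq_or_lt with rfl | hx0
    · simp only [sub_self, Complex.ofReal_zero, mul_zero, norm_zero]
      positivity
    · have hx' : (x : ℂ) ≠ 0 := by exact_mod_cast hx0.ne'
      have h1 := hb (x := x) hx0 (by
        rw [dist_zero_right, Real.norm_of_nonneg hx0.le]
        exact hx.2.trans_lt hrδ)
      rw [dist_eq_norm] at h1
      have e : dr u x - dr u 0 - dr (dr u) 0 * x
          = ((dr u x - dr u 0) / (x : ℂ) - dr (dr u) 0) * x := by
        field_simp
      rw [e, norm_mul, Complex.norm_real, Real.norm_of_nonneg hx0.le]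
      exact mul_le_mul h1.le hx.2 hx0.le (half_pos hε).le
  have h2 := (convex_Icc 0 r).norm_image_sub_le_of_norm_hasDerivWithin_le hd hbd
    (left_mem_Icc.2 hr.le) (right_mem_Icc.2 hr.le)
  simp only [h0, Complex.ofReal_zero, mul_zero, sub_zero, ne_eq, OfNat.ofNat_ne_zero,
    not_false_eq_true, zero_pow, Real.norm_of_nonneg hr.le] at h2
  have hr' : (r : ℂ) ≠ 0 := by exact_mod_cast hr.ne'
  have e : (u r - dr u 0 * r) / (r : ℂ) ^ 2 - dr (dr u) 0 / 2
      = (u r - dr u 0 * r - dr (dr u) 0 / 2 * (r : ℂ) ^ 2) / (r : ℂ) ^ 2 := by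
    field_simp
  rw [dist_eq_norm, e, norm_div, norm_pow, Complex.norm_real, Real.norm_of_nonneg hr.le,
    div_lt_iff₀ (by positivity)]
  have : 0 < ε * r ^ 2 := by positivity
  nlinarith

end Origin

/-! ### The transformed function and its derivative -/

/-- The image `h = u' + u / r` of `u`, as a function. -/
def fac (u : ℝ → ℂ) (r : ℝ) : ℂ := dr u r + u r / (r : ℂ)

/-- The derivative of `h = u' + u / r`, written through `w = T u - (2/r) u'(0)` as
`-w + (h - 2 u'(0)) / r`; this form shows its size at infinity. -/
def facDeriv (u : ℝ → ℂ) (r : ℝ) : ℂ := -Tadd u r + (fac u r - 2 * dr u 0) / (r : ℂ)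

section Transformed

variable {u : ℝ → ℂ}

theorem hasDerivAt_fac (hu : TwiceDiff u) {r : ℝ} (hr : 0 < r) :
    HasDerivAt (fac u) (facDeriv u r) r := by
  have hr' : (r : ℂ) ≠ 0 := by exact_mod_cast hr.ne'
  refine ((hu.hasDerivAt_dr hr).add
    ((hu.hasDerivAt hr).div (hasDerivAt_id r).ofReal_comp hr')).congr_deriv ?_
  rw [facDeriv, Tadd, indicator_of_mem (mem_Ioi.2 hr), T, indicator_of_mem (mem_Ioi.2 hr), fac]
  simp only [id, Complex.ofReal_one]
  field_simp
  ring

theorem isPrim_fac (hu : TwiceDiff u) (hw : MemH (Tadd u)) : IsPrim (fac u) (facDeriv u) := by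
  refine IsPrim.of_hasDerivAt (fun r hr => hasDerivAt_fac hu hr) ?_
  have h1 := (IsPrim.of_memH hw).continuousOn
  have h2 : ContinuousOn (fac u) (Ioi 0) := fun r hr =>
    (hasDerivAt_fac hu hr).continuousAt.continuousWithinAt
  refine h1.neg.add ((h2.sub continuousOn_const).div (by fun_prop) fun r hr => ?_)
  exact_mod_cast (ne_of_gt (mem_Ioi.1 hr))

theorem isPrim_facDeriv (hu : TwiceDiff u) (hw : MemH (Tadd u)) :
    IsPrim (facDeriv u) (fun r => -fac (Tadd u) r) := by
  have h1 := ((IsPrim.const 0).sub (IsPrim.of_memH hw)).add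
    (((isPrim_fac hu hw).sub (IsPrim.const (2 * dr u 0))).mul IsPrim.inv)
  refine h1.congr (fun r _ => ?_) ?_
  · simp only [facDeriv, div_eq_mul_inv, zero_sub]
  · filter_upwards [ae_hl_pos] with r hr
    have hr' : (r : ℂ) ≠ 0 := by exact_mod_cast hr.ne'
    simp only [facDeriv, fac]
    field_simp
    ring

theorem tendsto_fac (hu : TwiceDiff u) (h0 : u 0 = 0) :
    Tendsto (fac u) (𝓝[>] 0) (𝓝 (2 * dr u 0)) := by
  rw [two_mul]
  exact hu.tendsto_dr.add (hu.tendsto_div h0)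

theorem tendsto_facDeriv (hu : TwiceDiff u) (h0 : u 0 = 0) (hw : MemH (Tadd u)) :
    Tendsto (facDeriv u) (𝓝[>] 0) (𝓝 (3 / 2 * dr (dr u) 0)) := by
  have h1 := hw.tendsto_zero.neg.add (hu.tendsto_dr_sub_div.add (hu.tendsto_sub_div_sq h0))
  rw [show -0 + (dr (dr u) 0 + dr (dr u) 0 / 2) = 3 / 2 * dr (dr u) 0 by ring] at h1
  refine h1.congr' ?_
  filter_upwards [self_mem_nhdsWithin] with r hr
  have hr' : (r : ℂ) ≠ 0 := by exact_mod_cast (ne_of_gt (mem_Ioi.1 hr))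
  simp only [facDeriv, fac]
  field_simp
  ring

theorem memLp_fac (hu : MemH u) : MemLp (fac u) 2 hl :=
  hu.memLp_dr.add hu.memLp_div

theorem memLp_facDeriv_div (hu : MemH u) (hw : MemH (Tadd u)) :
    MemLp (fun r : ℝ => facDeriv u r / (r : ℂ)) 2 (volume.restrict (Ioi 1)) := by
  have hle : volume.restrict (Ioi (1 : ℝ)) ≤ hl :=
    Measure.restrict_mono (Ioi_subset_Ioi zero_le_one) le_rfl
  have hm : Measurable fun r : ℝ => ((r : ℂ) ^ 2)⁻¹ := by fun_prop
  have h1 := hw.memLp_div.mono_measure hle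
  have h2 : MemLp (fun r : ℝ => fac u r * ((r : ℂ) ^ 2)⁻¹) 2 (volume.restrict (Ioi 1)) := by
    have h := (memLp_fac hu).mono_measure hle
    refine h.mono (h.1.mul hm.aestronglyMeasurable) ?_
    filter_upwards [ae_restrict_mem measurableSet_Ioi] with r hr
    have hr1 : 1 < r := hr
    rw [norm_mul, norm_inv, norm_pow, Complex.norm_real, Real.norm_of_nonneg (by linarith)]
    exact mul_le_of_le_one_right (norm_nonneg _) (inv_le_one_of_one_le₀ (one_le_pow₀ hr1.le))
  have h3 : MemLp (fun r : ℝ => 2 * dr u 0 * ((r : ℂ) ^ 2)⁻¹) 2 (volume.restrict (Ioi 1)) := by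
    have h : MemLp ((Ioi 1).indicator fun r : ℝ => ((r : ℂ) ^ 2)⁻¹) 2 hl := by
      refine memLp_two_of_norm_le (ε := 1) (C := 1)
        (hm.indicator measurableSet_Ioi).aestronglyMeasurable one_pos (fun r hr => ?_) fun r hr => ?_
      · exact indicator_of_notMem (by simpa using hr.le) _
      · by_cases hr1 : r ∈ Ioi (1 : ℝ)
        · rw [indicator_of_mem hr1, norm_inv, norm_pow, Complex.norm_real,
            Real.norm_of_nonneg hr.le, one_div]
          exact inv_anti₀ hr (le_self_pow₀ (le_of_lt hr1) two_ne_zero)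
        · rw [indicator_of_notMem hr1, norm_zero]
          positivity
    rw [memLp_indicator_iff_restrict measurableSet_Ioi, hl,
      Measure.restrict_restrict measurableSet_Ioi,
      inter_eq_left.2 (Ioi_subset_Ioi zero_le_one)] at h
    exact h.const_mul _
  refine (memLp_congr_ae ?_).1 ((h2.sub h1).sub h3)
  filter_upwards [ae_restrict_mem measurableSet_Ioi] with r hr
  have hr' : (r : ℂ) ≠ 0 := by exact_mod_cast (ne_of_gt (one_pos.trans (mem_Ioi.1 hr)))
  simp only [Pi.sub_apply, facDeriv]
  field_simp
  ring

end Transformed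

/-! ### Symmetry -/

/-- The Wronskian `conj(h₁) h₂' - conj(h₁') h₂` of the transformed functions vanishes at both ends:
at `0` by the Robin condition `h'(0) = κ h(0)`, at infinity by square integrability. -/
theorem inner_Tk {κ : ℝ} (u v : (Tk κ).domain) :
    inner ℂ (Tk κ u) (v : H) = inner ℂ (u : H) (Tk κ v) := by
  obtain ⟨u, hu, hwu, hku⟩ := u
  obtain ⟨v, hv, hwv, hkv⟩ := v
  change inner ℂ (H.mk (Tadd u.fn) hwu) v = inner ℂ u (H.mk (Tadd v.fn) hwv)
  have hu0 := u.memH.zero_of_nonpos 0 le_rfl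
  have hv0 := v.memH.zero_of_nonpos 0 le_rfl
  have hΦ := ((isPrim_fac hu hwu).star.mul (isPrim_facDeriv hv hwv)).sub
    ((isPrim_facDeriv hu hwu).star.mul (isPrim_fac hv hwv))
  have i1 := L2.integrable_inner (𝕜 := ℂ) (factor (H.mk (Tadd u.fn) hwu)) (factor v)
  have i2 := L2.integrable_inner (𝕜 := ℂ) (factor u) (factor (H.mk (Tadd v.fn) hwv))
  have e : (fun r => inner ℂ (factor (H.mk (Tadd u.fn) hwu) r) (factor v r)
      - inner ℂ (factor u r) (factor (H.mk (Tadd v.fn) hwv) r)) =ᵐ[hl] fun r : ℝ =>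
      conj (facDeriv u.fn r) * facDeriv v.fn r + conj (fac u.fn r) * -fac (Tadd v.fn) r
        - (conj (-fac (Tadd u.fn) r) * fac v.fn r
          + conj (facDeriv u.fn r) * facDeriv v.fn r) := by
    filter_upwards [coeFn_factor u, coeFn_factor v, coeFn_factor (H.mk (Tadd u.fn) hwu),
      coeFn_factor (H.mk (Tadd v.fn) hwv)] with r h1 h2 h3 h4
    rw [h1, h2, h3, h4]
    simp only [RCLike.inner_apply, H.fn_mk, map_neg]
    simp only [fac]
    ring
  have hle : volume.restrict (Ioi (1 : ℝ)) ≤ hl :=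
    Measure.restrict_mono (Ioi_subset_Ioi zero_le_one) le_rfl
  have hd : IntegrableOn (fun r : ℝ => (conj (fac u.fn r) * facDeriv v.fn r
      - conj (facDeriv u.fn r) * fac v.fn r) / (r : ℂ)) (Ioi 1) := by
    have j1 := (((memLp_fac u.memH).mono_measure hle).star).integrable_mul
      (memLp_facDeriv_div v.memH hwv)
    have j2 := ((memLp_facDeriv_div u.memH hwu).star).integrable_mul
      ((memLp_fac v.memH).mono_measure hle)
    refine (j1.sub j2).congr (Eventually.of_forall fun r => ?_)
    simp only [Pi.sub_apply, Pi.mul_apply, Pi.star_apply, RCLike.star_def, map_div₀,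
      Complex.conj_ofReal]
    ring
  have hL : Tendsto (fun r => conj (fac u.fn r) * facDeriv v.fn r
      - conj (facDeriv u.fn r) * fac v.fn r) (𝓝[>] 0) (𝓝 0) := by
    have hcu := (Complex.continuous_conj.tendsto _).comp (tendsto_fac hu hu0)
    have hcu' := (Complex.continuous_conj.tendsto _).comp (tendsto_facDeriv hu hu0 hwu)
    have h1 := (hcu.mul (tendsto_facDeriv hv hv0 hwv)).sub (hcu'.mul (tendsto_fac hv hv0))
    have e0 : conj (2 * dr u.fn 0) * (3 / 2 * dr (dr v.fn) 0)
        - conj (3 / 2 * dr (dr u.fn) 0) * (2 * dr v.fn 0) = 0 := by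
      rw [show 3 / 2 * dr (dr u.fn) 0 = 2 * κ * dr u.fn 0 by linear_combination hku / 2,
        show 3 / 2 * dr (dr v.fn) 0 = 2 * κ * dr v.fn 0 by linear_combination hkv / 2]
      simp only [map_mul, Complex.conj_ofReal, Complex.conj_ofNat]
      ring
    rwa [e0] at h1
  have h0 := hΦ.integral_hl ((i1.sub i2).congr e) hd hL
  rw [← integral_congr_ae e, integral_sub i1 i2, ← L2.inner_def, ← L2.inner_def, inner_factor,
    inner_factor, neg_zero] at h0
  exact sub_eq_zero.1 h0

/-! ### The extension and its self-adjointness -/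

/-- If `T u ∈ ℋ` for a smooth `u`, then `r T u → 0` at the origin, which forces `u'(0) = 0`. -/
theorem dr_zero_of_mem_W0 {u : H} (hu : u ∈ W0) : dr u.fn 0 = 0 := by
  obtain ⟨hs, hT, -⟩ := hu
  have hd := twiceDiff_of_smooth hs
  have h2 : ContinuousOn (dr (dr u.fn)) (Ici 0) :=
    (((contDiffOn_infty_iff_derivWithin (uniqueDiffOn_Ici 0)).1
      ((contDiffOn_infty_iff_derivWithin (uniqueDiffOn_Ici 0)).1 hs).2).2).continuousOn
  have h3 : Tendsto (dr (dr u.fn)) (𝓝[>] 0) (𝓝 (dr (dr u.fn) 0)) :=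
    (h2 0 (mem_Ici.2 le_rfl)).mono_left (nhdsWithin_mono 0 Ioi_subset_Ici_self)
  have h4 := (tendsto_ofReal_zero.mul (hT.tendsto_zero.add h3)).div_const 2
  rw [zero_mul, zero_div] at h4
  have h5 := hd.tendsto_div (u.memH.zero_of_nonpos 0 le_rfl)
  refine tendsto_nhds_unique (h5.congr' ?_) h4
  filter_upwards [self_mem_nhdsWithin] with r hr
  have hr' : (r : ℂ) ≠ 0 := by exact_mod_cast (ne_of_gt (mem_Ioi.1 hr))
  rw [T, indicator_of_mem hr]
  field_simp
  ring

theorem Tadd_eq_T_of_mem_W0 {u : H} (hu : u ∈ W0) : Tadd u.fn = T u.fn := by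
  funext r
  by_cases hr : r ∈ Ioi (0 : ℝ)
  · rw [Tadd, indicator_of_mem hr, dr_zero_of_mem_W0 hu, mul_zero, sub_zero]
  · rw [Tadd, T, indicator_of_notMem hr, indicator_of_notMem hr]

theorem Ttilde_le_Tk (κ : ℝ) : Ttilde ≤ Tk κ := by
  refine ⟨fun u hu => ⟨twiceDiff_of_smooth hu.1, ?_, ?_⟩, fun u v huv => ?_⟩
  · rw [Tadd_eq_T_of_mem_W0 hu]
    exact hu.2.1
  · rw [hu.2.2, dr_zero_of_mem_W0 hu, mul_zero, mul_zero]
  · refine H.ext ?_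
    change T (u : H).fn = Tadd (v : H).fn
    rw [← huv, Tadd_eq_T_of_mem_W0 u.2]

end RadialLaplace

namespace LinearPMap

/-- A densely defined symmetric operator `A` such that `A + c` is onto for a real `c` is
self-adjoint. -/
theorem isSelfAdjoint_of_surjective_add {𝕜 E : Type*} [RCLike 𝕜] [NormedAddCommGroup E]
    [InnerProductSpace 𝕜 E] [CompleteSpace E] {A : E →ₗ.[𝕜] E}
    (hd : Dense (A.domain : Set E)) (hs : A.IsFormalAdjoint A) (c : ℝ)
    (hc : ∀ f : E, ∃ x : A.domain, A x + (c : 𝕜) • (x : E) = f) : IsSelfAdjoint A := by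
  rw [LinearPMap.isSelfAdjoint_def]
  have hle : A ≤ A.adjoint := hs.le_adjoint hd
  refine (LinearPMap.eq_of_le_of_domain_eq hle (le_antisymm hle.1 fun y hy => ?_)).symm
  -- `y` differs from the solution `x` of `(A + c) x = (A† + c) y` by an element that is
  -- orthogonal to the range of `A + c`
  obtain ⟨x, hx⟩ := hc (A.adjoint ⟨y, hy⟩ + (c : 𝕜) • y)
  obtain ⟨z, hz⟩ := hc (y - x)
  have h1 : inner 𝕜 (A.adjoint ⟨y, hy⟩) (z : E) = inner 𝕜 y (A z) :=
    adjoint_isFormalAdjoint hd ⟨y, hy⟩ z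
  have h2 : inner 𝕜 (A x) (z : E) = inner 𝕜 (x : E) (A z) := hs x z
  have h3 : inner 𝕜 (y - x) (y - x) = (0 : 𝕜) := by
    have h4 := congrArg (fun w => inner 𝕜 w (z : E)) hx
    simp only [inner_add_left, inner_smul_left, RCLike.conj_ofReal, h1, h2] at h4
    nth_rewrite 2 [← hz]
    rw [inner_add_right, inner_smul_right, inner_sub_left, inner_sub_left]
    linear_combination -h4
  have h5 : y = x := sub_eq_zero.1 (inner_self_eq_zero.1 h3)
  rw [h5]
  exact x.2

end LinearPMap

theorem mainTheorem2 (κ : ℝ) :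
    Dense (RadialLaplace.Ttilde.domain : Set RadialLaplace.H) ∧
      RadialLaplace.Ttilde.IsFormalAdjoint RadialLaplace.Ttilde ∧
      RadialLaplace.Ttilde ≤ RadialLaplace.Tk κ ∧
      IsSelfAdjoint (RadialLaplace.Tk κ) := by
  have hle := RadialLaplace.Ttilde_le_Tk κ
  have hdense : Dense (RadialLaplace.Ttilde.domain : Set RadialLaplace.H) :=
    RadialLaplace.dense_W0
  refine ⟨hdense, fun u v => ?_, hle, ?_⟩
  · have hu : RadialLaplace.Ttilde u = RadialLaplace.Tk κ ⟨u, hle.1 u.2⟩ := hle.2 rfl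
    have hv : RadialLaplace.Ttilde v = RadialLaplace.Tk κ ⟨v, hle.1 v.2⟩ := hle.2 rfl
    rw [hu, hv]
    exact RadialLaplace.inner_Tk ⟨u, hle.1 u.2⟩ ⟨v, hle.1 v.2⟩
  · refine LinearPMap.isSelfAdjoint_of_surjective_add (hdense.mono hle.1)
      (fun u v => RadialLaplace.inner_Tk u v) ((|κ| + 1) ^ 2) fun f => ?_
    obtain ⟨u, hu, hf⟩ := RadialLaplace.exists_mem_W_Tadd_add (lt_add_one |κ|) f
    refine ⟨⟨u, hu⟩, RadialLaplace.H.ext ?_⟩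
    rw [← hf]
    change RadialLaplace.Tadd u.fn + (((|κ| + 1) ^ 2 : ℝ) : ℂ) • u.fn = _
    push_cast
    rfl
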